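/- Conventions. Manifolds are smooth, finite-dimensional, Hausdorff and $\sigma$-compact; vector bundles are real, smooth and of finite rank. Let $q_E\colon E\to M$ and $q_{E'}\colon E'\to M'$ be vector bundles. A *fibration of vector bundles* $\varphi\colon E\to E'$ over $\varphi_0\colon M\to M'$ is a smooth vector bundle morphism over $\varphi_0$ such that $\varphi_0$ is a smooth surjective submersion with connected fibres and $\varphi_m\colon E_m\to E'_{\varphi_0(m)}$ is surjective for every $m\in M$. Put $K:=\ker\varphi\subseteq E$ and $F_M:=\ker T\varphi_0\subseteq TM$ (an involutive subbundle), and write $e\mapsto\bar e$, $X\mapsto\bar X$ for the projections $\Gamma(E)\to\Gamma(E/K)$ and $\Gamma(TM)\to\Gamma(TM/F_M)$. Let $\nabla^{F_M}$ be the Bott connection, $\nabla^{F_M}_Y\bar X=\overline{[Y,X]}$ for $Y\in\Gamma(F_M)$. The Atiyah class. Let $\nabla^p\colon\Gamma(F_M)\times\Gamma(E/K)\to\Gamma(E/K)$ be a flat $F_M$-connection. An *extension* of $\nabla^p$ is a linear connection $\nabla\colon\mathfrak X(M)\times\Gamma(E)\to\Gamma(E)$ with $\nabla_X k\in\Gamma(K)$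 for all $X\in\mathfrak X(M)$, $k\in\Gamma(K)$, and $\overline{\nabla_Y e}=\nabla^p_Y\bar e$ for all $Y\in\Gamma(F_M)$, $e\in\Gamma(E)$. It defines the form $$\omega_\nabla\in\Omega^1\bigl(F_M,\operatorname{Hom}(TM/F_M,\operatorname{End}(E/K))\bigr),\qquad \omega_\nabla(Y)(\bar X)(\bar e)=\overline{R_\nabla(Y,X)e},$$ which is closed for the differential $\mathbf d_{\nabla^p}$ of the flat $F_M$-connection $(\nabla_Y\phi)(\bar X)(\bar e)=\nabla^p_Y(\phi(\bar X)\bar e)-\phi(\nabla^{F_M}_Y\bar X)\bar e-\phi(\bar X)(\nabla^p_Y\bar e)$ on $\operatorname{Hom}(TM/F_M,\operatorname{End}(E/K))$. The *Atiyah class* of $\nabla^p$ is $\alpha_{\nabla^p}=[\omega_\nabla]\in H^1_{\mathbf d_{\nabla^p}}(F_M,\operatorname{Hom}(TM/F_M,\operatorname{End}(E/K)))$ for any extension $\nabla$ of $\nabla^p$ (extensions exist and the class does not depend on the choice). **Theorem.** Let $\varphi\colon E\to E'$ be a fibration of vector bundles over $\varphi_0\colon M\to M'$. There is a unique flat $F_M$-connection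 $\nabla^\varphi\colon\Gamma(F_M)\times\Gamma(E/K)\to\Gamma(E/K)$ such that $\nabla^\varphi_Y\bar e=0$ for all $Y\in\Gamma(F_M)$ and all $e\in\Gamma(E)$ for which there is an $e'\in\Gamma(E')$ with $\varphi\circ e=e'\circ\varphi_0$. Its Atiyah class vanishes, $\alpha_{\nabla^\varphi}=0$: the connection $\nabla^\varphi$ has an extension, and $[\omega_\nabla]=0$ for every extension $\nabla$ of $\nabla^\varphi$. -/

import Mathlib

open Bundle Manifold VectorField Set Filter
open scoped Manifold ContDiff Topology

noncomputable section

namespace FlatFibration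

/-! ## Smooth functions, smooth sections, vector fields -/

/-- The ring `C^∞(M)` of smooth real functions. -/
abbrev Fn (B : Type*) [NormedAddCommGroup B] [NormedSpace ℝ B]
    (M : Type*) [TopologicalSpace M] [ChartedSpace B M] : Type _ :=
  C^∞⟮𝓘(ℝ, B), M; 𝓘(ℝ), ℝ⟯

/-- The space `Γ(E)` of smooth sections of a vector bundle `E → M` with typical fibre `F`. -/
abbrev Sec (B : Type*) [NormedAddCommGroup B] [NormedSpace ℝ B]
    {M : Type*} [TopologicalSpace M] [ChartedSpace B M]
    (F : Type*) [NormedAddCommGroup F] [NormedSpace ℝ F]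
    (E : M → Type*) [TopologicalSpace (TotalSpace F E)] [∀ x, TopologicalSpace (E x)]
    [FiberBundle F E] : Type _ :=
  Cₛ^∞⟮𝓘(ℝ, B); F, E⟯

/-- The space `𝔛(M) = Γ(TM)` of smooth vector fields. -/
abbrev VecField (B : Type*) [NormedAddCommGroup B] [NormedSpace ℝ B]
    (M : Type*) [TopologicalSpace M] [ChartedSpace B M] [IsManifold 𝓘(ℝ, B) ∞ M] : Type _ :=
  Sec B B (TangentSpace 𝓘(ℝ, B) : M → Type _)

section Modules

variable {B : Type*} [NormedAddCommGroup B] [NormedSpace ℝ B]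
  {M : Type*} [TopologicalSpace M] [ChartedSpace B M]
  {F : Type*} [NormedAddCommGroup F] [NormedSpace ℝ F]
  {E : M → Type*} [TopologicalSpace (TotalSpace F E)] [∀ x, AddCommGroup (E x)]
  [∀ x, Module ℝ (E x)] [∀ x, TopologicalSpace (E x)] [FiberBundle F E] [VectorBundle ℝ F E]

instance : SMul (Fn B M) (Sec B F E) :=
  ⟨fun f e ↦ ⟨fun x ↦ f x • e x, f.contMDiff.smul_section e.contMDiff⟩⟩

theorem Sec.fn_smul_apply (f : Fn B M) (e : Sec B F E) (x : M) : (f • e) x = f x • e x := rfl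

theorem Sec.add_apply (e e' : Sec B F E) (x : M) : (e + e') x = e x + e' x := rfl

instance : Module (Fn B M) (Sec B F E) where
  one_smul e := by ext x; simp [Sec.fn_smul_apply]
  mul_smul f g e := by ext x; simp [Sec.fn_smul_apply, mul_smul]
  smul_zero f := by ext x; simp [Sec.fn_smul_apply]
  smul_add f e e' := by ext x; simp [Sec.fn_smul_apply, Sec.add_apply]
  add_smul f g e := by ext x; simp [Sec.fn_smul_apply, Sec.add_apply, add_smul]
  zero_smul e := by ext x; simp [Sec.fn_smul_apply]

instance : IsScalarTower ℝ (Fn B M) (Sec B F E) where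
  smul_assoc r f e := by
    ext x; simp [Sec.fn_smul_apply, mul_smul]

/-- `Γ(S)`: the smooth sections of `E` with values in the subspaces `S x ⊆ E x`. -/
def subSec (B : Type*) [NormedAddCommGroup B] [NormedSpace ℝ B] {M : Type*} [TopologicalSpace M]
    [ChartedSpace B M] (F : Type*) [NormedAddCommGroup F] [NormedSpace ℝ F]
    {E : M → Type*} [TopologicalSpace (TotalSpace F E)] [∀ x, AddCommGroup (E x)]
    [∀ x, Module ℝ (E x)] [∀ x, TopologicalSpace (E x)] [FiberBundle F E] [VectorBundle ℝ F E]
    (S : ∀ x, Submodule ℝ (E x)) : Submodule (Fn B M) (Sec B F E) where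
  carrier := {e | ∀ x, e x ∈ S x}
  add_mem' h h' x := (S x).add_mem (h x) (h' x)
  zero_mem' x := (S x).zero_mem
  smul_mem' f _ h x := (S x).smul_mem (f x) (h x)

/-- `Γ(E/S)`: the smooth sections of the quotient bundle with fibres `E x / S x`. A section of the
quotient is smooth when it is locally the class of a smooth local section of `E`. -/
@[ext]
structure QuotSec (B : Type*) [NormedAddCommGroup B] [NormedSpace ℝ B] {M : Type*}
    [TopologicalSpace M] [ChartedSpace B M] (F : Type*) [NormedAddCommGroup F] [NormedSpace ℝ F]
    {E : M → Type*} [TopologicalSpace (TotalSpace F E)] [∀ x, AddCommGroup (E x)]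
    [∀ x, Module ℝ (E x)] [∀ x, TopologicalSpace (E x)] [FiberBundle F E] [VectorBundle ℝ F E]
    (S : ∀ x, Submodule ℝ (E x)) where
  /-- the value at a point -/
  val : ∀ x, E x ⧸ S x
  smooth : ∀ x₀, ∃ U ∈ 𝓝 x₀, ∃ e : ∀ x, E x,
    ContMDiffOn 𝓘(ℝ, B) (𝓘(ℝ, B).prod 𝓘(ℝ, F)) ∞
      (fun x ↦ (⟨x, e x⟩ : TotalSpace F E)) U ∧
    ∀ x ∈ U, val x = (S x).mkQ (e x)

namespace QuotSec

variable {S : ∀ x, Submodule ℝ (E x)}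

instance : Zero (QuotSec B F S) :=
  ⟨⟨fun _ ↦ 0, fun _ ↦ ⟨univ, univ_mem, fun _ ↦ 0,
    (0 : Sec B F E).contMDiff.contMDiffOn, fun _ _ ↦ (map_zero _).symm⟩⟩⟩

instance : Add (QuotSec B F S) :=
  ⟨fun s t ↦ ⟨fun x ↦ s.val x + t.val x, fun x₀ ↦ by
    obtain ⟨U, hU, e, he, hs⟩ := s.smooth x₀
    obtain ⟨U', hU', e', he', ht⟩ := t.smooth x₀
    refine ⟨U ∩ U', inter_mem hU hU', fun x ↦ e x + e' x,
      (he.mono inter_subset_left).add_section (he'.mono inter_subset_right), fun x hx ↦ ?_⟩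
    rw [hs x hx.1, ht x hx.2, map_add]⟩⟩

instance : SMul (Fn B M) (QuotSec B F S) :=
  ⟨fun f s ↦ ⟨fun x ↦ f x • s.val x, fun x₀ ↦ by
    obtain ⟨U, hU, e, he, hs⟩ := s.smooth x₀
    refine ⟨U, hU, fun x ↦ f x • e x, f.contMDiff.contMDiffOn.smul_section he, fun x hx ↦ ?_⟩
    rw [hs x hx, map_smul]⟩⟩

instance : Neg (QuotSec B F S) :=
  ⟨fun s ↦ ⟨fun x ↦ - s.val x, fun x₀ ↦ by
    obtain ⟨U, hU, e, he, hs⟩ := s.smooth x₀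
    refine ⟨U, hU, fun x ↦ - e x, he.neg_section, fun x hx ↦ ?_⟩
    rw [hs x hx, map_neg]⟩⟩

theorem zero_val (x : M) : (0 : QuotSec B F S).val x = 0 := rfl
theorem add_val (s t : QuotSec B F S) (x : M) : (s + t).val x = s.val x + t.val x := rfl
theorem neg_val (s : QuotSec B F S) (x : M) : (-s).val x = - s.val x := rfl
theorem smul_val (f : Fn B M) (s : QuotSec B F S) (x : M) : (f • s).val x = f x • s.val x := rfl

instance : AddCommGroup (QuotSec B F S) where
  add_assoc a b c := by ext x; simp [add_val, add_assoc]
  zero_add a := by ext x; simp [add_val, zero_val]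
  add_zero a := by ext x; simp [add_val, zero_val]
  add_comm a b := by ext x; simp [add_val, add_comm]
  neg_add_cancel a := by ext x; simp [add_val, neg_val, zero_val]
  nsmul := nsmulRec
  zsmul := zsmulRec

instance : Module (Fn B M) (QuotSec B F S) where
  one_smul e := by ext x; simp [smul_val]
  mul_smul f g e := by ext x; simp [smul_val, mul_smul]
  smul_zero f := by ext x; simp [smul_val, zero_val]
  smul_add f e e' := by ext x; simp [smul_val, add_val]
  add_smul f g e := by ext x; simp [smul_val, add_val, add_smul]
  zero_smul e := by ext x; simp [smul_val, zero_val]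

instance : Module ℝ (QuotSec B F S) := Module.compHom _ (algebraMap ℝ (Fn B M))

instance : IsScalarTower ℝ (Fn B M) (QuotSec B F S) where
  smul_assoc r f s := by
    rw [Algebra.smul_def, mul_smul]; rfl

/-- The projection `Γ(E) → Γ(E/S)`, `e ↦ ē`. -/
def proj (S : ∀ x, Submodule ℝ (E x)) : Sec B F E →ₗ[Fn B M] QuotSec B F S where
  toFun e := ⟨fun x ↦ (S x).mkQ (e x), fun _ ↦
    ⟨univ, univ_mem, e, e.contMDiff.contMDiffOn, fun _ _ ↦ rfl⟩⟩
  map_add' e e' := by ext x; rfl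
  map_smul' f e := by ext x; rfl

theorem proj_val (e : Sec B F E) (x : M) : (proj S e).val x = (S x).mkQ (e x) := rfl

theorem proj_eq_zero_iff (e : Sec B F E) : proj S e = 0 ↔ e ∈ subSec B F S := by
  constructor
  · intro h x
    have := congrArg (fun s : QuotSec B F S ↦ s.val x) h
    simpa [proj_val, zero_val] using this
  · intro h
    ext x
    simpa [proj_val, zero_val] using h x

theorem ker_proj : LinearMap.ker (proj S : Sec B F E →ₗ[Fn B M] QuotSec B F S) = subSec B F S := by
  ext e; exact proj_eq_zero_iff e

variable [FiniteDimensional ℝ B] [IsManifold 𝓘(ℝ, B) ∞ M] [T2Space M] [SigmaCompactSpace M]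

/-- Every smooth section of the quotient lifts to a global smooth section. -/
theorem proj_surjective : Function.Surjective (proj S : Sec B F E →ₗ[Fn B M] QuotSec B F S) := by
  intro s
  obtain ⟨e, he⟩ := exists_contMDiffSection_forall_mem_convex_of_local 𝓘(ℝ, B) (n := ⊤)
    (F_fiber := F) E (fun x ↦ {v | (S x).mkQ v = s.val x})
    (fun x ↦ (convex_singleton (s.val x)).linear_preimage (S x).mkQ)
    (fun x₀ ↦ by
      obtain ⟨U, hU, e, he, hs⟩ := s.smooth x₀
      exact ⟨U, hU, e, he, fun y hy ↦ (hs y hy).symm⟩)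
  exact ⟨e, by ext x; exact he x⟩

/-- A `C^∞(M)`-linear map on `Γ(E)` that vanishes on `Γ(S)` descends to `Γ(E/S)`. -/
def lift {N : Type*} [AddCommGroup N] [Module (Fn B M) N] (T : Sec B F E →ₗ[Fn B M] N)
    (hT : ∀ e ∈ subSec B F S, T e = 0) : QuotSec B F S →ₗ[Fn B M] N :=
  (Submodule.liftQ (LinearMap.ker (proj S)) T (fun e he ↦ hT e ((proj_eq_zero_iff e).1 he))).comp
    ((proj S).quotKerEquivOfSurjective proj_surjective).symm.toLinearMap

theorem lift_proj {N : Type*} [AddCommGroup N] [Module (Fn B M) N] (T : Sec B F E →ₗ[Fn B M] N)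
    (hT : ∀ e ∈ subSec B F S, T e = 0) (e : Sec B F E) : lift T hT (proj S e) = T e := by
  have h : ((proj S).quotKerEquivOfSurjective proj_surjective).symm (proj S e)
      = Submodule.Quotient.mk e := by
    rw [LinearEquiv.symm_apply_eq]; rfl
  rw [lift, LinearMap.comp_apply, LinearEquiv.coe_coe, h]
  rfl

end QuotSec

end Modules

/-! ## Vector fields as derivations, the Lie bracket -/

section VectorFields

variable {B : Type*} [NormedAddCommGroup B] [NormedSpace ℝ B]
  {M : Type*} [TopologicalSpace M] [ChartedSpace B M] [IsManifold 𝓘(ℝ, B) ∞ M]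

/-- The derivative `X f` of a smooth function along a vector field. -/
def dirDeriv (X : VecField B M) (f : Fn B M) : Fn B M :=
  ⟨fun x ↦ mvfderiv 𝓘(ℝ, B) f x (X x), by
    have h1 : ContMDiff 𝓘(ℝ, B).tangent 𝓘(ℝ, ℝ).tangent ∞ (tangentMap 𝓘(ℝ, B) 𝓘(ℝ, ℝ) f) :=
      f.contMDiff.contMDiff_tangentMap (by simp)
    exact (contMDiff_snd_tangentBundle_modelSpace ℝ 𝓘(ℝ, ℝ)).comp (h1.comp X.contMDiff)⟩

theorem dirDeriv_apply (X : VecField B M) (f : Fn B M) (x : M) :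
    dirDeriv X f x = mvfderiv 𝓘(ℝ, B) f x (X x) := rfl

variable [FiniteDimensional ℝ B]

/-- The Lie bracket `[X, Y]` of smooth vector fields. -/
def lie (X Y : VecField B M) : VecField B M :=
  ⟨mlieBracket 𝓘(ℝ, B) X Y, by
    have : IsManifold 𝓘(ℝ, B) (((⊤ : ℕ∞) : ℕ∞ω) + 1) M := by
      simpa using (inferInstance : IsManifold 𝓘(ℝ, B) ∞ M)
    have : IsManifold 𝓘(ℝ, B) (minSmoothness ℝ 2) M := by
      simp only [minSmoothness_of_isRCLikeNormedField]; infer_instance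
    have := FiniteDimensional.complete ℝ B
    exact ContDiff.mlieBracket_vectorField (m := ⊤) (n := ⊤) X.contMDiff Y.contMDiff (by simp)⟩

theorem lie_apply (X Y : VecField B M) (x : M) :
    lie X Y x = mlieBracket 𝓘(ℝ, B) X Y x := rfl

theorem Fn.mdiffAt (f : Fn B M) (x : M) : MDifferentiableAt 𝓘(ℝ, B) 𝓘(ℝ, ℝ) f x :=
  f.contMDiff.mdifferentiable (by simp) x

theorem two_le_infty : (2 : ℕ∞ω) ≤ ∞ := by
  exact WithTop.coe_le_coe.2 (le_top : (2 : ℕ∞) ≤ ⊤)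

theorem lie_swap (X Y : VecField B M) : lie X Y = - lie Y X := by
  ext x
  exact mlieBracket_swap_apply

theorem lie_add_right (X Y Z : VecField B M) : lie X (Y + Z) = lie X Y + lie X Z := by
  ext x
  exact mlieBracket_add_right Y.mdifferentiableAt Z.mdifferentiableAt

theorem lie_add_left (X Y Z : VecField B M) : lie (X + Y) Z = lie X Z + lie Y Z := by
  rw [lie_swap, lie_add_right, lie_swap Z X, lie_swap Z Y]; abel

theorem lie_smul_right (f : Fn B M) (X Y : VecField B M) :
    lie X (f • Y) = dirDeriv X f • Y + f • lie X Y := by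
  ext x
  exact mlieBracket_smul_right (f.mdiffAt x) Y.mdifferentiableAt

theorem lie_smul_left (f : Fn B M) (X Y : VecField B M) :
    lie (f • X) Y = - (dirDeriv Y f • X) + f • lie X Y := by
  rw [lie_swap, lie_smul_right, lie_swap Y X, smul_neg]; abel

theorem lie_lie (X Y Z : VecField B M) :
    lie X (lie Y Z) = lie (lie X Y) Z + lie Y (lie X Z) := by
  have := FiniteDimensional.complete ℝ B
  have : IsManifold 𝓘(ℝ, B) (minSmoothness ℝ 3) M := by
    simp only [minSmoothness_of_isRCLikeNormedField]; infer_instance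
  ext x
  have h (X : VecField B M) : ContMDiffAt 𝓘(ℝ, B) (𝓘(ℝ, B).prod 𝓘(ℝ, B)) (minSmoothness ℝ 2)
      (fun x ↦ (⟨x, X x⟩ : TangentBundle 𝓘(ℝ, B) M)) x := by
    simp only [minSmoothness_of_isRCLikeNormedField]
    exact X.contMDiff.contMDiffAt.of_le two_le_infty
  exact leibniz_identity_mlieBracket_apply (h X) (h Y) (h Z)


theorem dirDeriv_add_right (X : VecField B M) (f g : Fn B M) :
    dirDeriv X (f + g) = dirDeriv X f + dirDeriv X g := by
  ext x
  exact congrArg (fun l ↦ l (X x)) (mvfderiv_add (f.mdiffAt x) (g.mdiffAt x))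

theorem dirDeriv_mul (X : VecField B M) (f g : Fn B M) :
    dirDeriv X (f * g) = f * dirDeriv X g + g * dirDeriv X f := by
  ext x
  exact congrArg (fun l ↦ l (X x)) (mvfderiv_mul (f.mdiffAt x) (g.mdiffAt x))

theorem dirDeriv_add_left (X Y : VecField B M) (f : Fn B M) :
    dirDeriv (X + Y) f = dirDeriv X f + dirDeriv Y f := by
  ext x
  exact map_add (mvfderiv 𝓘(ℝ, B) f x) (X x) (Y x)

theorem dirDeriv_smul_left (g : Fn B M) (X : VecField B M) (f : Fn B M) :
    dirDeriv (g • X) f = g * dirDeriv X f := by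
  ext x
  exact map_smul (mvfderiv 𝓘(ℝ, B) f x) (g x) (X x)

/-- The derivative along `[V, W]` is the commutator of the derivatives along `V` and `W`. -/
theorem mvfderiv_mlieBracket {G : Type*} [NormedAddCommGroup G] [NormedSpace ℝ G]
    {g : M → G} {x : M} (hg : ContMDiffAt 𝓘(ℝ, B) 𝓘(ℝ, G) 2 g x) (V W : VecField B M)
    (hV : MDifferentiableAt 𝓘(ℝ, B) 𝓘(ℝ, G) (fun y ↦ mvfderiv 𝓘(ℝ, B) g y (V y)) x)
    (hW : MDifferentiableAt 𝓘(ℝ, B) 𝓘(ℝ, G) (fun y ↦ mvfderiv 𝓘(ℝ, B) g y (W y)) x) :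
    mvfderiv 𝓘(ℝ, B) g x (mlieBracket 𝓘(ℝ, B) V W x) =
      mvfderiv 𝓘(ℝ, B) (fun y ↦ mvfderiv 𝓘(ℝ, B) g y (W y)) x (V x) -
      mvfderiv 𝓘(ℝ, B) (fun y ↦ mvfderiv 𝓘(ℝ, B) g y (V y)) x (W x) := by
  set c := extChartAt 𝓘(ℝ, B) x with hc
  have hcs : ∀ᶠ z in 𝓝 (c x), z ∈ c.target := extChartAt_target_mem_nhds x
  have hinv : c.symm (c x) = x := extChartAt_to_inv x
  have hsymm : ∀ z ∈ c.target, MDifferentiableAt 𝓘(ℝ, B) 𝓘(ℝ, B) c.symm z := fun z hz ↦ by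
    have h := (contMDiffOn_extChartAt_symm (I := 𝓘(ℝ, B)) (n := ∞) x) z hz
    exact (h.contMDiffAt ((isOpen_extChartAt_target x).mem_nhds hz)).mdifferentiableAt (by simp)
  have hiso : ∀ z ∈ c.target, (mfderiv 𝓘(ℝ, B) 𝓘(ℝ, B) c.symm z).IsInvertible := fun z hz ↦ by
    have h := isInvertible_mfderivWithin_extChartAt_symm (I := 𝓘(ℝ, B)) hz
    rwa [modelWithCornersSelf_coe, range_id, mfderivWithin_univ] at h
  have hgn : ∀ᶠ y in 𝓝 x, ContMDiffAt 𝓘(ℝ, B) 𝓘(ℝ, G) 2 g y := by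
    exact (contMDiffAt_iff_contMDiffAt_nhds (by simp)).1 hg
  let pb : (∀ y : M, TangentSpace 𝓘(ℝ, B) y) → B → B :=
    fun X ↦ mpullback 𝓘(ℝ, B) 𝓘(ℝ, B) c.symm X
  have key : ∀ h : M → G, ∀ z ∈ c.target, MDifferentiableAt 𝓘(ℝ, B) 𝓘(ℝ, G) h (c.symm z) →
      ∀ X : (∀ y : M, TangentSpace 𝓘(ℝ, B) y), fderiv ℝ (h ∘ c.symm) z (pb X z) =
        mvfderiv 𝓘(ℝ, B) h (c.symm z) (X (c.symm z)) := by
    intro h z hz hh X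
    have h1 := mfderiv_comp_apply z hh (hsymm z hz) (mpullback 𝓘(ℝ, B) 𝓘(ℝ, B) c.symm X z)
    rw [mpullback_apply, (hiso z hz).self_apply_inverse] at h1
    rw [mfderiv_eq_fderiv] at h1
    exact h1
  have hx : c x ∈ c.target := mem_extChartAt_target x
  have := FiniteDimensional.complete ℝ B
  have : IsManifold 𝓘(ℝ, B) (minSmoothness ℝ 2) M := by
    simp only [minSmoothness_of_isRCLikeNormedField]; infer_instance
  have hdiff : ∀ X : VecField B M, DifferentiableAt ℝ (pb X) (c x) := fun X ↦ by
    have h := MDifferentiableWithinAt.differentiableWithinAt_mpullbackWithin_vectorField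
      (X.mdifferentiableAt (x := x)).mdifferentiableWithinAt (s := univ)
    rw [modelWithCornersSelf_coe, range_id, preimage_univ, univ_inter,
      mpullbackWithin_univ] at h
    exact differentiableWithinAt_univ.1 h
  have hbr : pb (mlieBracket 𝓘(ℝ, B) V W) (c x) = lieBracket ℝ (pb V) (pb W) (c x) := by
    have h := mpullback_mlieBracket (I := 𝓘(ℝ, B)) (I' := 𝓘(ℝ, B)) (f := c.symm) (x₀ := c x)
      (n := ∞) (V := V) (W := W) V.mdifferentiableAt W.mdifferentiableAt
      ((contMDiffOn_extChartAt_symm x).contMDiffAt ((isOpen_extChartAt_target x).mem_nhds hx))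
      (by simp only [minSmoothness_of_isRCLikeNormedField]; exact two_le_infty)
    rw [← mlieBracketWithin_univ, ← mlieBracketWithin_univ,
      mlieBracketWithin_eq_lieBracketWithin, mlieBracketWithin_univ] at h
    have h' : pb (mlieBracket 𝓘(ℝ, B) V W) (c x) =
        lieBracketWithin ℝ (pb V) (pb W) univ (c x) := h
    rwa [lieBracketWithin_univ] at h'
  have hgc : ContDiffAt ℝ 2 (g ∘ c.symm) (c x) := by
    rw [← contMDiffAt_iff_contDiffAt]
    refine ContMDiffAt.comp (c x) (by rwa [hinv]) ?_
    exact ((contMDiffOn_extChartAt_symm x).contMDiffAt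
      ((isOpen_extChartAt_target x).mem_nhds hx)).of_le le_rfl
  have hcont : ContinuousAt c.symm (c x) := continuousAt_extChartAt_symm x
  have hev : ∀ X : VecField B M, (fun z ↦ fderiv ℝ (g ∘ c.symm) z (pb X z)) =ᶠ[𝓝 (c x)]
        (fun y ↦ mvfderiv 𝓘(ℝ, B) g y (X y)) ∘ c.symm := fun X ↦ by
    filter_upwards [hcs, hcont.eventually (by rwa [hinv])] with z hz hgz
    exact key g z hz (hgz.mdifferentiableAt (by simp)) X
  have h1 := fderiv_apply_lieBracket hgc (by simp) (hdiff W) (hdiff V)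
  rw [← hbr, key g _ hx (by rw [hinv]; exact hg.mdifferentiableAt (by simp)), (hev V).fderiv_eq,
    (hev W).fderiv_eq, key _ _ hx (by rwa [hinv]), key _ _ hx (by rwa [hinv]), hinv] at h1
  exact h1

theorem dirDeriv_lie (X Y : VecField B M) (f : Fn B M) :
    dirDeriv (lie X Y) f = dirDeriv X (dirDeriv Y f) - dirDeriv Y (dirDeriv X f) := by
  ext x
  exact mvfderiv_mlieBracket (f.contMDiff.contMDiffAt.of_le two_le_infty) X Y
    ((dirDeriv X f).mdiffAt x) ((dirDeriv Y f).mdiffAt x)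

end VectorFields
/-! ## Involutive families of tangent subspaces -/

/-- A family of subspaces `F_x ⊆ T_xM` whose smooth sections are closed under the Lie bracket. An
involutive subbundle `F_M ⊆ TM` is such a family. -/
structure InvolutiveFamily (B : Type*) [NormedAddCommGroup B] [NormedSpace ℝ B]
    [FiniteDimensional ℝ B] (M : Type*) [TopologicalSpace M] [ChartedSpace B M]
    [IsManifold 𝓘(ℝ, B) ∞ M] where
  /-- the subspace at a point -/
  fiber : ∀ x : M, Submodule ℝ (TangentSpace 𝓘(ℝ, B) x)
  lie_mem : ∀ Y₁ ∈ subSec B B fiber, ∀ Y₂ ∈ subSec B B fiber, lie Y₁ Y₂ ∈ subSec B B fiber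

namespace InvolutiveFamily

variable {B : Type*} [NormedAddCommGroup B] [NormedSpace ℝ B] [FiniteDimensional ℝ B]
  {M : Type*} [TopologicalSpace M] [ChartedSpace B M] [IsManifold 𝓘(ℝ, B) ∞ M]
  (FM : InvolutiveFamily B M)

/-- `Γ(F_M)`. -/
abbrev Γ : Submodule (Fn B M) (VecField B M) := subSec B B FM.fiber

/-- The Lie bracket on `Γ(F_M)`. -/
def bracket (Y₁ Y₂ : FM.Γ) : FM.Γ := ⟨lie (Y₁ : VecField B M) Y₂, FM.lie_mem _ Y₁.2 _ Y₂.2⟩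

end InvolutiveFamily

/-- `T^{φ₀}M = ker Tφ₀`, the tangent spaces to the fibres of `φ₀ : M → M'`. -/
def vertical {B : Type*} [NormedAddCommGroup B] [NormedSpace ℝ B] [FiniteDimensional ℝ B]
    {M : Type*} [TopologicalSpace M] [ChartedSpace B M] [IsManifold 𝓘(ℝ, B) ∞ M]
    {B' : Type*} [NormedAddCommGroup B'] [NormedSpace ℝ B']
    {M' : Type*} [TopologicalSpace M'] [ChartedSpace B' M'] [IsManifold 𝓘(ℝ, B') ∞ M']
    (φ₀ : M → M') (hφ₀ : ContMDiff 𝓘(ℝ, B) 𝓘(ℝ, B') ∞ φ₀) : InvolutiveFamily B M where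
  fiber x := LinearMap.ker (mfderiv 𝓘(ℝ, B) 𝓘(ℝ, B') φ₀ x).toLinearMap
  lie_mem Y₁ h₁ Y₂ h₂ x := by
    set c := extChartAt 𝓘(ℝ, B') (φ₀ x) with hc
    have hcs : ∀ y ∈ c.source, ContMDiffAt 𝓘(ℝ, B') 𝓘(ℝ, B') ∞ c y := fun y hy ↦
      (contMDiffOn_extChartAt (n := ∞)).contMDiffAt
        ((chartAt B' (φ₀ x)).open_source.mem_nhds (by rwa [hc, extChartAt_source] at hy))
    have hx : φ₀ x ∈ c.source := mem_extChartAt_source (φ₀ x)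
    have hev : ∀ᶠ y in 𝓝 x, φ₀ y ∈ c.source :=
      hφ₀.continuous.continuousAt.eventually (extChartAt_source_mem_nhds (φ₀ x))
    have hg : ContMDiffAt 𝓘(ℝ, B) 𝓘(ℝ, B') 2 (c ∘ φ₀) x :=
      ((hcs _ hx).comp x hφ₀.contMDiffAt).of_le two_le_infty
    have hcomp : ∀ y, φ₀ y ∈ c.source → ∀ v : TangentSpace 𝓘(ℝ, B) y,
        mvfderiv 𝓘(ℝ, B) (c ∘ φ₀) y v =
          mfderiv 𝓘(ℝ, B') 𝓘(ℝ, B') c (φ₀ y) (mfderiv 𝓘(ℝ, B) 𝓘(ℝ, B') φ₀ y v) :=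
      fun y hy v ↦ mfderiv_comp_apply y ((hcs _ hy).mdifferentiableAt (by simp))
        (hφ₀.mdifferentiable (by simp) y) v
    have hzero : ∀ Y ∈ subSec B B (fun x ↦
        LinearMap.ker (mfderiv 𝓘(ℝ, B) 𝓘(ℝ, B') φ₀ x).toLinearMap),
        (fun y ↦ mvfderiv 𝓘(ℝ, B) (c ∘ φ₀) y (Y y)) =ᶠ[𝓝 x] fun _ ↦ (0 : B') := fun Y hY ↦ by
      filter_upwards [hev] with y hy
      have h := hY y
      rw [LinearMap.mem_ker] at h
      rw [hcomp y hy]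
      exact (congrArg _ h).trans (map_zero _)
    have hdiff : ∀ Y ∈ subSec B B (fun x ↦
        LinearMap.ker (mfderiv 𝓘(ℝ, B) 𝓘(ℝ, B') φ₀ x).toLinearMap),
        MDifferentiableAt 𝓘(ℝ, B) 𝓘(ℝ, B') (fun y ↦ mvfderiv 𝓘(ℝ, B) (c ∘ φ₀) y (Y y)) x :=
      fun Y hY ↦ (mdifferentiableAt_const (c := (0 : B'))).congr_of_eventuallyEq (hzero Y hY)
    have hder : ∀ Y ∈ subSec B B (fun x ↦
        LinearMap.ker (mfderiv 𝓘(ℝ, B) 𝓘(ℝ, B') φ₀ x).toLinearMap), ∀ v,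
        mvfderiv 𝓘(ℝ, B) (fun y ↦ mvfderiv 𝓘(ℝ, B) (c ∘ φ₀) y (Y y)) x v = 0 := fun Y hY v ↦ by
      have h := (hzero Y hY).mfderiv_eq (I := 𝓘(ℝ, B)) (I' := 𝓘(ℝ, B'))
      rw [mfderiv_const] at h
      exact congrArg (fun l ↦ l v) h
    have h := mvfderiv_mlieBracket hg Y₁ Y₂ (hdiff _ h₁) (hdiff _ h₂)
    rw [hder _ h₁, hder _ h₂, sub_zero, hcomp x hx] at h
    have hinj := (isInvertible_mfderiv_extChartAt (I := 𝓘(ℝ, B')) hx).injective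
    rw [LinearMap.mem_ker]
    exact hinj (h.trans (map_zero _).symm)


/-! ## Flat partial connections -/

section Connections

variable {B : Type*} [NormedAddCommGroup B] [NormedSpace ℝ B] [FiniteDimensional ℝ B]
  {M : Type*} [TopologicalSpace M] [ChartedSpace B M] [IsManifold 𝓘(ℝ, B) ∞ M]
  {F : Type*} [NormedAddCommGroup F] [NormedSpace ℝ F]
  {E : M → Type*} [TopologicalSpace (TotalSpace F E)] [∀ x, AddCommGroup (E x)]
  [∀ x, Module ℝ (E x)] [∀ x, TopologicalSpace (E x)] [FiberBundle F E] [VectorBundle ℝ F E]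

/-- A flat `F_M`-connection `∇ : Γ(F_M) × Γ(E/S) → Γ(E/S)`. -/
structure FlatPartialConnection (B : Type*) [NormedAddCommGroup B] [NormedSpace ℝ B]
    [FiniteDimensional ℝ B] {M : Type*} [TopologicalSpace M] [ChartedSpace B M]
    [IsManifold 𝓘(ℝ, B) ∞ M] (F : Type*) [NormedAddCommGroup F] [NormedSpace ℝ F]
    {E : M → Type*} [TopologicalSpace (TotalSpace F E)] [∀ x, AddCommGroup (E x)]
    [∀ x, Module ℝ (E x)] [∀ x, TopologicalSpace (E x)] [FiberBundle F E] [VectorBundle ℝ F E]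
    (FM : InvolutiveFamily B M) (S : ∀ x, Submodule ℝ (E x)) where
  /-- the operation `(Y, s) ↦ ∇_Y s` -/
  toFun : FM.Γ → QuotSec B F S → QuotSec B F S
  add_left : ∀ Y₁ Y₂ s, toFun (Y₁ + Y₂) s = toFun Y₁ s + toFun Y₂ s
  smul_left : ∀ (f : Fn B M) Y s, toFun (f • Y) s = f • toFun Y s
  add_right : ∀ Y s₁ s₂, toFun Y (s₁ + s₂) = toFun Y s₁ + toFun Y s₂
  leibniz : ∀ Y (f : Fn B M) s, toFun Y (f • s) = dirDeriv (Y : VecField B M) f • s + f • toFun Y s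
  flat : ∀ Y₁ Y₂ s,
    toFun Y₁ (toFun Y₂ s) - toFun Y₂ (toFun Y₁ s) - toFun (FM.bracket Y₁ Y₂) s = 0

namespace FlatPartialConnection

variable {FM : InvolutiveFamily B M} {S : ∀ x, Submodule ℝ (E x)}

instance : CoeFun (FlatPartialConnection B F FM S)
    fun _ ↦ FM.Γ → QuotSec B F S → QuotSec B F S := ⟨toFun⟩

variable (D : FlatPartialConnection B F FM S)

theorem zero_right (Y : FM.Γ) : D Y 0 = 0 := by
  have h := D.add_right Y 0 0
  rwa [add_zero, left_eq_add] at h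

theorem neg_right (Y : FM.Γ) (s : QuotSec B F S) : D Y (-s) = - D Y s := by
  rw [eq_neg_iff_add_eq_zero, ← D.add_right, neg_add_cancel, D.zero_right]

theorem sub_right (Y : FM.Γ) (s t : QuotSec B F S) : D Y (s - t) = D Y s - D Y t := by
  rw [sub_eq_add_neg, D.add_right, D.neg_right, ← sub_eq_add_neg]

theorem const_smul_right (Y : FM.Γ) (r : ℝ) (s : QuotSec B F S) : D Y (r • s) = r • D Y s := by
  have h (t : QuotSec B F S) : r • t = algebraMap ℝ (Fn B M) r • t := rfl
  have h0 : dirDeriv (Y : VecField B M) (algebraMap ℝ (Fn B M) r) = 0 := by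
    ext x
    exact congrArg (fun l ↦ l ((Y : VecField B M) x)) (mvfderiv_const (c := r) (x := x))
  rw [h, h, D.leibniz, h0, zero_smul, zero_add]

end FlatPartialConnection

variable [T2Space M] [SigmaCompactSpace M]

section Bott

variable (FM : InvolutiveFamily B M)

/-- `∇_Y X̄ = \overline{[Y, X]}` for any representative `X` of `X̄ ∈ Γ(TM/F_M)`. -/
def bottFun (Y : FM.Γ) (s : QuotSec B B FM.fiber) : QuotSec B B FM.fiber :=
  QuotSec.proj FM.fiber (lie (Y : VecField B M) (Function.surjInv QuotSec.proj_surjective s))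

theorem bottFun_proj (Y : FM.Γ) (X : VecField B M) :
    bottFun FM Y (QuotSec.proj FM.fiber X) = QuotSec.proj FM.fiber (lie (Y : VecField B M) X) := by
  have h := Function.surjInv_eq (QuotSec.proj_surjective (S := FM.fiber) (B := B) (F := B))
    (QuotSec.proj FM.fiber X)
  rw [bottFun, ← sub_eq_zero, ← map_sub, QuotSec.proj_eq_zero_iff]
  rw [← sub_eq_zero, ← map_sub, QuotSec.proj_eq_zero_iff] at h
  have h2 := FM.lie_mem _ Y.2 _ h
  rw [sub_eq_add_neg, ← neg_one_smul (Fn B M), lie_add_right, lie_smul_right] at h2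
  have h0 : dirDeriv (Y : VecField B M) (-1) = 0 := by
    ext x
    exact congrArg (fun l ↦ l ((Y : VecField B M) x)) (mvfderiv_const (c := (-1 : ℝ)) (x := x))
  rwa [h0, zero_smul, zero_add, neg_one_smul, ← sub_eq_add_neg] at h2

/-- The Bott connection `∇^{F_M} : Γ(F_M) × Γ(TM/F_M) → Γ(TM/F_M)`. -/
def bott : FlatPartialConnection B B FM FM.fiber where
  toFun := bottFun FM
  add_left Y₁ Y₂ s := by
    obtain ⟨X, rfl⟩ := QuotSec.proj_surjective s
    simp only [bottFun_proj, Submodule.coe_add, lie_add_left, map_add]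
  smul_left f Y s := by
    obtain ⟨X, rfl⟩ := QuotSec.proj_surjective s
    simp only [bottFun_proj, Submodule.coe_smul, lie_smul_left, map_add, map_smul, map_neg]
    rw [(QuotSec.proj_eq_zero_iff _).2 Y.2, smul_zero, neg_zero, zero_add]
  add_right Y s t := by
    obtain ⟨X, rfl⟩ := QuotSec.proj_surjective s
    obtain ⟨X', rfl⟩ := QuotSec.proj_surjective t
    rw [← map_add, bottFun_proj, bottFun_proj, bottFun_proj, lie_add_right, map_add]
  leibniz Y f s := by
    obtain ⟨X, rfl⟩ := QuotSec.proj_surjective s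
    rw [← map_smul, bottFun_proj, bottFun_proj, lie_smul_right, map_add, map_smul, map_smul]
  flat Y₁ Y₂ s := by
    obtain ⟨X, rfl⟩ := QuotSec.proj_surjective s
    simp only [bottFun_proj, InvolutiveFamily.bracket]
    rw [lie_lie (Y₁ : VecField B M), map_add]
    abel

theorem bott_proj (Y : FM.Γ) (X : VecField B M) :
    bott FM Y (QuotSec.proj FM.fiber X) = QuotSec.proj FM.fiber (lie (Y : VecField B M) X) :=
  bottFun_proj FM Y X

end Bott

/-! ## The complex computing `H¹(F_M, Hom(TM/F_M, End(E/S)))` -/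

section Cohomology

variable {FM : InvolutiveFamily B M} {S : ∀ x, Submodule ℝ (E x)}

/-- `Γ(Hom(TM/F_M, End(E/S)))`, as the `C^∞(M)`-linear maps `Γ(TM/F_M) → End(Γ(E/S))`. -/
abbrev Form0 (B : Type*) [NormedAddCommGroup B] [NormedSpace ℝ B]
    [FiniteDimensional ℝ B] {M : Type*} [TopologicalSpace M] [ChartedSpace B M]
    [IsManifold 𝓘(ℝ, B) ∞ M] (F : Type*) [NormedAddCommGroup F] [NormedSpace ℝ F]
    {E : M → Type*} [TopologicalSpace (TotalSpace F E)] [∀ x, AddCommGroup (E x)]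
    [∀ x, Module ℝ (E x)] [∀ x, TopologicalSpace (E x)] [FiberBundle F E] [VectorBundle ℝ F E]
    (FM : InvolutiveFamily B M) (S : ∀ x, Submodule ℝ (E x)) : Type _ :=
  QuotSec B B FM.fiber →ₗ[Fn B M] (QuotSec B F S →ₗ[Fn B M] QuotSec B F S)

/-- `Ω¹(F_M, Hom(TM/F_M, End(E/S)))`, as the `C^∞(M)`-linear maps
`Γ(F_M) → Γ(Hom(TM/F_M, End(E/S)))`. -/
abbrev Form1 (B : Type*) [NormedAddCommGroup B] [NormedSpace ℝ B]
    [FiniteDimensional ℝ B] {M : Type*} [TopologicalSpace M] [ChartedSpace B M]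
    [IsManifold 𝓘(ℝ, B) ∞ M] (F : Type*) [NormedAddCommGroup F] [NormedSpace ℝ F]
    {E : M → Type*} [TopologicalSpace (TotalSpace F E)] [∀ x, AddCommGroup (E x)]
    [∀ x, Module ℝ (E x)] [∀ x, TopologicalSpace (E x)] [FiberBundle F E] [VectorBundle ℝ F E]
    (FM : InvolutiveFamily B M) (S : ∀ x, Submodule ℝ (E x)) : Type _ :=
  FM.Γ →ₗ[Fn B M] Form0 B F FM S

variable (D : FlatPartialConnection B F FM S)

/-- The connection on `Hom(TM/F_M, End(E/S))` induced by the Bott connection and `∇`: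
`(∇_Y φ)(X̄)(ē) = ∇_Y(φ(X̄)ē) - φ(∇_Y X̄)ē - φ(X̄)(∇_Y ē)`. -/
def homConn (Y : FM.Γ) (φ : Form0 B F FM S) : Form0 B F FM S where
  toFun X :=
    { toFun := fun e ↦ D Y (φ X e) - φ (bott FM Y X) e - φ X (D Y e)
      map_add' := fun e e' ↦ by
        simp only [map_add, D.add_right]; abel
      map_smul' := fun f e ↦ by
        simp only [map_smul, D.leibniz, map_add, RingHom.id_apply, smul_sub]; abel }
  map_add' X X' := by
    ext1 e
    simp only [map_add, LinearMap.add_apply, LinearMap.coe_mk, AddHom.coe_mk, D.add_right,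
      (bott FM).add_right]
    abel
  map_smul' f X := by
    ext1 e
    simp only [map_add, map_smul, LinearMap.add_apply, LinearMap.smul_apply, LinearMap.coe_mk,
      AddHom.coe_mk, D.leibniz, (bott FM).leibniz, RingHom.id_apply, smul_sub]
    abel

theorem homConn_apply (Y : FM.Γ) (φ : Form0 B F FM S) (X : QuotSec B B FM.fiber)
    (e : QuotSec B F S) :
    homConn D Y φ X e = D Y (φ X e) - φ (bott FM Y X) e - φ X (D Y e) := rfl

/-- The differential `d_∇ : Ω⁰ → Ω¹`, `(d_∇ φ)(Y) = ∇_Y φ`. -/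
def d0 : Form0 B F FM S →ₗ[ℝ] Form1 B F FM S where
  toFun φ :=
    { toFun := fun Y ↦ homConn D Y φ
      map_add' := fun Y Y' ↦ by
        ext1 X; ext1 e
        simp only [homConn_apply, LinearMap.add_apply, D.add_left, (bott FM).add_left, map_add]
        abel
      map_smul' := fun f Y ↦ by
        ext1 X; ext1 e
        simp only [homConn_apply, LinearMap.smul_apply, D.smul_left, (bott FM).smul_left, map_smul,
          RingHom.id_apply, smul_sub] }
  map_add' φ ψ := by
    ext1 Y; ext1 X; ext1 e
    simp only [LinearMap.coe_mk, AddHom.coe_mk, homConn_apply, LinearMap.add_apply, D.add_right]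
    abel
  map_smul' r φ := by
    ext1 Y; ext1 X; ext1 e
    simp only [LinearMap.coe_mk, AddHom.coe_mk, homConn_apply, LinearMap.smul_apply,
      D.const_smul_right, RingHom.id_apply, smul_sub]

/-- The differential `d_∇ : Ω¹ → Ω²`,
`(d_∇ ω)(Y₁, Y₂) = ∇_{Y₁}(ω(Y₂)) - ∇_{Y₂}(ω(Y₁)) - ω([Y₁, Y₂])`, where a 2-form is recorded by its
values on `Γ(F_M) × Γ(F_M)`. -/
def d1 : Form1 B F FM S →ₗ[ℝ] (FM.Γ → FM.Γ → Form0 B F FM S) where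
  toFun α Y₁ Y₂ := homConn D Y₁ (α Y₂) - homConn D Y₂ (α Y₁) - α (FM.bracket Y₁ Y₂)
  map_add' α β := by
    ext1 Y₁; ext1 Y₂; ext1 X; ext1 e
    simp only [Pi.add_apply, LinearMap.sub_apply, homConn_apply, LinearMap.add_apply, D.add_right]
    abel
  map_smul' r α := by
    ext1 Y₁; ext1 Y₂; ext1 X; ext1 e
    simp only [Pi.smul_apply, LinearMap.sub_apply, homConn_apply, LinearMap.smul_apply,
      D.const_smul_right, RingHom.id_apply, smul_sub]

instance : AddCommGroup (Form1 B F FM S) := LinearMap.addCommGroup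

/-- `H¹_{d_∇}(F_M, Hom(TM/F_M, End(E/S)))`: closed 1-forms modulo exact 1-forms. -/
abbrev H1 : Type _ :=
  LinearMap.ker (d1 D) ⧸ (LinearMap.range (d0 D)).submoduleOf (LinearMap.ker (d1 D))

end Cohomology

/-! ## Connections on `E`, extensions and the Atiyah class -/

section Atiyah

/-- A smooth linear connection `∇ : 𝔛(M) × Γ(E) → Γ(E)`. -/
structure LinearConnection (B : Type*) [NormedAddCommGroup B] [NormedSpace ℝ B]
    {M : Type*} [TopologicalSpace M] [ChartedSpace B M]
    [IsManifold 𝓘(ℝ, B) ∞ M] (F : Type*) [NormedAddCommGroup F] [NormedSpace ℝ F]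
    (E : M → Type*) [TopologicalSpace (TotalSpace F E)] [∀ x, AddCommGroup (E x)]
    [∀ x, Module ℝ (E x)] [∀ x, TopologicalSpace (E x)] [∀ x, IsTopologicalAddGroup (E x)]
    [∀ x, ContinuousSMul ℝ (E x)] [FiberBundle F E] [VectorBundle ℝ F E] where
  /-- the underlying covariant derivative -/
  cov : CovariantDerivative 𝓘(ℝ, B) F E
  smooth : CovariantDerivative.ContMDiffCovariantDerivative cov ∞

variable [∀ x, IsTopologicalAddGroup (E x)] [∀ x, ContinuousSMul ℝ (E x)]

namespace LinearConnection

variable (C : LinearConnection B F E)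

/-- The section `∇_X e`. -/
def nabla (X : VecField B M) (e : Sec B F E) : Sec B F E :=
  ⟨fun x ↦ C.cov e x (X x), by
    have h := contMDiffOn_univ.1 (C.smooth.contMDiff.contMDiff (σ := e)
      (contMDiffOn_univ.2 (by simpa using e.contMDiff)))
    exact h.clm_bundle_apply X.contMDiff⟩

theorem nabla_apply (X : VecField B M) (e : Sec B F E) (x : M) :
    C.nabla X e x = C.cov e x (X x) := rfl

theorem nabla_add_left (X Y : VecField B M) (e : Sec B F E) :
    C.nabla (X + Y) e = C.nabla X e + C.nabla Y e := by
  ext x; exact map_add (C.cov e x) (X x) (Y x)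

theorem nabla_smul_left (f : Fn B M) (X : VecField B M) (e : Sec B F E) :
    C.nabla (f • X) e = f • C.nabla X e := by
  ext x; exact map_smul (C.cov e x) (f x) (X x)

theorem nabla_add_right (X : VecField B M) (e e' : Sec B F E) :
    C.nabla X (e + e') = C.nabla X e + C.nabla X e' := by
  ext x
  exact congrArg (fun l ↦ l (X x)) (C.cov.isCovariantDerivativeOnUniv.add
    e.mdifferentiableAt e'.mdifferentiableAt)

theorem nabla_smul_right (X : VecField B M) (f : Fn B M) (e : Sec B F E) :
    C.nabla X (f • e) = dirDeriv X f • e + f • C.nabla X e := by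
  ext x
  have h := congrArg (fun l ↦ l (X x)) (C.cov.isCovariantDerivativeOnUniv.leibniz
    (e.mdifferentiableAt (x := x)) (f.mdiffAt x))
  refine h.trans ?_
  rw [Sec.add_apply, Sec.fn_smul_apply, Sec.fn_smul_apply, add_comm]
  rfl

theorem nabla_neg_left (X : VecField B M) (e : Sec B F E) : C.nabla (-X) e = - C.nabla X e := by
  rw [← neg_one_smul (Fn B M), nabla_smul_left, neg_one_smul]

theorem nabla_zero_right (X : VecField B M) : C.nabla X 0 = 0 := by
  have h := C.nabla_add_right X 0 0
  rwa [add_zero, left_eq_add] at h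

theorem nabla_neg_right (X : VecField B M) (e : Sec B F E) : C.nabla X (-e) = - C.nabla X e := by
  rw [eq_neg_iff_add_eq_zero, ← C.nabla_add_right, neg_add_cancel, C.nabla_zero_right]

theorem nabla_sub_right (X : VecField B M) (e e' : Sec B F E) :
    C.nabla X (e - e') = C.nabla X e - C.nabla X e' := by
  rw [sub_eq_add_neg, C.nabla_add_right, C.nabla_neg_right, ← sub_eq_add_neg]

/-- The curvature `R_∇(X, Y)e = ∇_X ∇_Y e - ∇_Y ∇_X e - ∇_{[X,Y]} e`. -/
def curv (X Y : VecField B M) (e : Sec B F E) : Sec B F E :=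
  C.nabla X (C.nabla Y e) - C.nabla Y (C.nabla X e) - C.nabla (lie X Y) e

theorem curv_add_left (X X' Y : VecField B M) (e : Sec B F E) :
    C.curv (X + X') Y e = C.curv X Y e + C.curv X' Y e := by
  simp only [curv, nabla_add_left, nabla_add_right, lie_add_left]; abel

theorem curv_smul_left (f : Fn B M) (X Y : VecField B M) (e : Sec B F E) :
    C.curv (f • X) Y e = f • C.curv X Y e := by
  simp only [curv, nabla_add_left, nabla_smul_left, nabla_smul_right, nabla_neg_left,
    lie_smul_left, smul_sub]
  abel

theorem curv_swap (X Y : VecField B M) (e : Sec B F E) : C.curv X Y e = - C.curv Y X e := by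
  rw [curv, curv, lie_swap X Y, nabla_neg_left]; abel

theorem curv_add_middle (X Y Y' : VecField B M) (e : Sec B F E) :
    C.curv X (Y + Y') e = C.curv X Y e + C.curv X Y' e := by
  rw [curv_swap, curv_add_left, curv_swap C X Y, curv_swap C X Y']; abel

theorem curv_smul_middle (f : Fn B M) (X Y : VecField B M) (e : Sec B F E) :
    C.curv X (f • Y) e = f • C.curv X Y e := by
  rw [curv_swap, curv_smul_left, curv_swap C X Y, smul_neg]

theorem curv_add_right (X Y : VecField B M) (e e' : Sec B F E) :
    C.curv X Y (e + e') = C.curv X Y e + C.curv X Y e' := by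
  simp only [curv, nabla_add_right]; abel

theorem curv_smul_right (f : Fn B M) (X Y : VecField B M) (e : Sec B F E) :
    C.curv X Y (f • e) = f • C.curv X Y e := by
  simp only [curv, nabla_smul_right, nabla_add_right, dirDeriv_lie, sub_smul, smul_sub]
  abel

/-- The curvature `R_∇(X, Y)` as a `C^∞(M)`-linear endomorphism of `Γ(E)`. -/
def curvEnd (X Y : VecField B M) : Sec B F E →ₗ[Fn B M] Sec B F E where
  toFun := C.curv X Y
  map_add' := C.curv_add_right X Y
  map_smul' f := C.curv_smul_right f X Y

end LinearConnection

variable {FM : InvolutiveFamily B M} {S : ∀ x, Submodule ℝ (E x)}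

/-- `∇` is an extension of the `F_M`-connection `∇^p` on `E/S`: it preserves `Γ(S)`, and the induced
connection `\bar∇_X ē = \overline{∇_X e}` on `E/S` agrees with `∇^p` along `F_M`. -/
structure IsExtension (D : FlatPartialConnection B F FM S) (C : LinearConnection B F E) :
    Prop where
  restricts : ∀ (X : VecField B M), ∀ k ∈ subSec B F S, C.nabla X k ∈ subSec B F S
  extends_ : ∀ (Y : FM.Γ) (e : Sec B F E),
    QuotSec.proj S (C.nabla Y e) = D Y (QuotSec.proj S e)

namespace IsExtension

variable {D : FlatPartialConnection B F FM S} {C : LinearConnection B F E}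

theorem curv_mem (h : IsExtension D C) (X Y : VecField B M) (k : Sec B F E) (hk : k ∈ subSec B F S) :
    C.curv X Y k ∈ subSec B F S :=
  Submodule.sub_mem _ (Submodule.sub_mem _ (h.restricts _ _ (h.restricts _ _ hk))
    (h.restricts _ _ (h.restricts _ _ hk))) (h.restricts _ _ hk)

theorem proj_curv (h : IsExtension D C) (Y₁ Y₂ : FM.Γ) (e : Sec B F E) :
    QuotSec.proj S (C.curv Y₁ Y₂ e) = 0 := by
  have h3 := h.extends_ (FM.bracket Y₁ Y₂) e
  rw [LinearConnection.curv, map_sub, map_sub, h.extends_, h.extends_, h.extends_, h.extends_]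
  rw [show lie (Y₁ : VecField B M) Y₂ = FM.bracket Y₁ Y₂ from rfl, h3]
  exact D.flat _ _ _

end IsExtension

/-- The endomorphism `ē ↦ \overline{R_∇(X, Y)e}` of `Γ(E/S)`. -/
def quotCurv {D : FlatPartialConnection B F FM S} {C : LinearConnection B F E}
    (h : IsExtension D C) (X Y : VecField B M) : (QuotSec B F S →ₗ[Fn B M] QuotSec B F S) :=
  QuotSec.lift ((QuotSec.proj S).comp (C.curvEnd X Y))
    (fun e he ↦ (QuotSec.proj_eq_zero_iff _).2 (h.curv_mem X Y e he))

theorem quotCurv_proj {D : FlatPartialConnection B F FM S} {C : LinearConnection B F E}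
    (h : IsExtension D C) (X Y : VecField B M) (e : Sec B F E) :
    quotCurv h X Y (QuotSec.proj S e) = QuotSec.proj S (C.curv X Y e) :=
  QuotSec.lift_proj _ _ e

/-- The `C^∞(M)`-linear map `X ↦ (ē ↦ \overline{R_∇(Y, X)e})`. -/
def quotCurvLin {D : FlatPartialConnection B F FM S} {C : LinearConnection B F E}
    (h : IsExtension D C) (Y : VecField B M) :
    VecField B M →ₗ[Fn B M] (QuotSec B F S →ₗ[Fn B M] QuotSec B F S) where
  toFun X := quotCurv h Y X
  map_add' X X' := by
    ext1 s
    obtain ⟨e, rfl⟩ := QuotSec.proj_surjective s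
    rw [LinearMap.add_apply, quotCurv_proj, quotCurv_proj, quotCurv_proj, C.curv_add_middle,
      map_add]
  map_smul' f X := by
    ext1 s
    obtain ⟨e, rfl⟩ := QuotSec.proj_surjective s
    rw [RingHom.id_apply, LinearMap.smul_apply, quotCurv_proj, quotCurv_proj, C.curv_smul_middle,
      map_smul]

theorem quotCurvLin_vanish {D : FlatPartialConnection B F FM S} {C : LinearConnection B F E}
    (h : IsExtension D C) (Y : FM.Γ) (X : VecField B M) (hX : X ∈ FM.Γ) :
    quotCurvLin h Y X = 0 := by
  ext1 s
  obtain ⟨e, rfl⟩ := QuotSec.proj_surjective s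
  exact (quotCurv_proj h _ _ e).trans (h.proj_curv Y ⟨X, hX⟩ e)

/-- `ω_∇(Y) ∈ Γ(Hom(TM/F_M, End(E/S)))`, `ω_∇(Y)(X̄)(ē) = \overline{R_∇(Y, X)e}`. -/
def atiyahFormAt {D : FlatPartialConnection B F FM S} {C : LinearConnection B F E}
    (h : IsExtension D C) (Y : FM.Γ) : Form0 B F FM S :=
  QuotSec.lift (quotCurvLin h Y) (quotCurvLin_vanish h Y)

theorem atiyahFormAt_proj {D : FlatPartialConnection B F FM S} {C : LinearConnection B F E}
    (h : IsExtension D C) (Y : FM.Γ) (X : VecField B M) (e : Sec B F E) :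
    atiyahFormAt h Y (QuotSec.proj FM.fiber X) (QuotSec.proj S e) =
      QuotSec.proj S (C.curv Y X e) := by
  rw [atiyahFormAt, QuotSec.lift_proj]
  exact quotCurv_proj h _ _ e

/-- The form `ω_∇ ∈ Ω¹(F_M, Hom(TM/F_M, End(E/S)))`, `ω_∇(Y)(X̄)(ē) = \overline{R_∇(Y, X)e}`. -/
def atiyahForm {D : FlatPartialConnection B F FM S} {C : LinearConnection B F E}
    (h : IsExtension D C) : Form1 B F FM S where
  toFun Y := atiyahFormAt h Y
  map_add' Y Y' := by
    ext1 t; ext1 s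
    obtain ⟨e, rfl⟩ := QuotSec.proj_surjective s
    obtain ⟨X, rfl⟩ := QuotSec.proj_surjective t
    rw [LinearMap.add_apply, LinearMap.add_apply, atiyahFormAt_proj, atiyahFormAt_proj,
      atiyahFormAt_proj, Submodule.coe_add, C.curv_add_left, map_add]
  map_smul' f Y := by
    ext1 t; ext1 s
    obtain ⟨e, rfl⟩ := QuotSec.proj_surjective s
    obtain ⟨X, rfl⟩ := QuotSec.proj_surjective t
    rw [RingHom.id_apply, LinearMap.smul_apply, LinearMap.smul_apply, atiyahFormAt_proj,
      atiyahFormAt_proj, Submodule.coe_smul, C.curv_smul_left, map_smul]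

theorem atiyahForm_proj {D : FlatPartialConnection B F FM S} {C : LinearConnection B F E}
    (h : IsExtension D C) (Y : FM.Γ) (X : VecField B M) (e : Sec B F E) :
    atiyahForm h Y (QuotSec.proj FM.fiber X) (QuotSec.proj S e) =
      QuotSec.proj S (C.curv Y X e) :=
  atiyahFormAt_proj h Y X e

theorem atiyahForm_closed {D : FlatPartialConnection B F FM S} {C : LinearConnection B F E}
    (h : IsExtension D C) : atiyahForm h ∈ LinearMap.ker (d1 D) := by
  rw [LinearMap.mem_ker]
  ext1 Y₁; ext1 Y₂; ext1 t; ext1 s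
  obtain ⟨e, rfl⟩ := QuotSec.proj_surjective s
  obtain ⟨X, rfl⟩ := QuotSec.proj_surjective t
  change homConn D Y₁ (atiyahForm h Y₂) (QuotSec.proj FM.fiber X) (QuotSec.proj S e)
    - homConn D Y₂ (atiyahForm h Y₁) (QuotSec.proj FM.fiber X) (QuotSec.proj S e)
    - atiyahForm h (FM.bracket Y₁ Y₂) (QuotSec.proj FM.fiber X) (QuotSec.proj S e) = 0
  rw [homConn_apply, homConn_apply, bott_proj, bott_proj, ← h.extends_, ← h.extends_]
  simp only [atiyahForm_proj]
  rw [← h.extends_, ← h.extends_]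
  have h1 := h.proj_curv Y₁ Y₂ (C.nabla X e)
  have h2 := (QuotSec.proj_eq_zero_iff _).2 (h.restricts X _ ((QuotSec.proj_eq_zero_iff _).1
    (h.proj_curv Y₁ Y₂ e)))
  have hb : ((FM.bracket Y₁ Y₂ : FM.Γ) : VecField B M) = lie (Y₁ : VecField B M) Y₂ := rfl
  have hj := lie_lie (Y₁ : VecField B M) Y₂ X
  rw [hb]
  simp only [LinearConnection.curv, C.nabla_sub_right, map_sub, hj, C.nabla_add_left, map_add]
    at h1 h2 ⊢
  rw [← sub_zero (0 : QuotSec B F S)]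
  nth_rewrite 1 [← h1]
  rw [← h2]
  abel

/-- The class `[ω_∇] ∈ H¹_{d_{∇^p}}(F_M, Hom(TM/F_M, End(E/S)))` of an extension `∇`. -/
def atiyahFormClass {D : FlatPartialConnection B F FM S} {C : LinearConnection B F E}
    (h : IsExtension D C) : H1 D :=
  Submodule.Quotient.mk ⟨atiyahForm h, atiyahForm_closed h⟩

/-- `α` is the Atiyah class of the flat partial connection `∇^p`: extensions of `∇^p` exist, and
`α = [ω_∇]` for every extension `∇` of `∇^p`. -/
def IsAtiyahClass (D : FlatPartialConnection B F FM S) (α : H1 D) : Prop :=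
  (∃ C : LinearConnection B F E, IsExtension D C) ∧
    ∀ (C : LinearConnection B F E) (h : IsExtension D C), atiyahFormClass h = α

end Atiyah

end Connections

/-! ## Fibrations of vector bundles -/

section Fibrations

variable {B : Type*} [NormedAddCommGroup B] [NormedSpace ℝ B] [FiniteDimensional ℝ B]
  {M : Type*} [TopologicalSpace M] [ChartedSpace B M] [IsManifold 𝓘(ℝ, B) ∞ M]
  {F : Type*} [NormedAddCommGroup F] [NormedSpace ℝ F]
  {E : M → Type*} [TopologicalSpace (TotalSpace F E)] [∀ x, AddCommGroup (E x)]
  [∀ x, Module ℝ (E x)] [∀ x, TopologicalSpace (E x)] [FiberBundle F E] [VectorBundle ℝ F E]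
  {B' : Type*} [NormedAddCommGroup B'] [NormedSpace ℝ B']
  {M' : Type*} [TopologicalSpace M'] [ChartedSpace B' M'] [IsManifold 𝓘(ℝ, B') ∞ M']
  {F' : Type*} [NormedAddCommGroup F'] [NormedSpace ℝ F']
  {E' : M' → Type*} [TopologicalSpace (TotalSpace F' E')] [∀ x, AddCommGroup (E' x)]
  [∀ x, Module ℝ (E' x)] [∀ x, TopologicalSpace (E' x)] [FiberBundle F' E'] [VectorBundle ℝ F' E']

/-- `φ : E → E'`, given by the linear maps `φ_x : E_x → E'_{φ₀(x)}`, is a fibration of vector bundles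
over `φ₀ : M → M'`: the map `φ₀` is a smooth surjective submersion with connected fibres, and
`φ^! : E → φ₀^!E'` is a smooth vector bundle morphism that is surjective in every fibre. -/
structure IsVBFibration (B F B' F' : Type*) [NormedAddCommGroup B] [NormedSpace ℝ B]
    [NormedAddCommGroup B'] [NormedSpace ℝ B']
    [NormedAddCommGroup F] [NormedSpace ℝ F] [NormedAddCommGroup F'] [NormedSpace ℝ F']
    {M : Type*} [TopologicalSpace M] [ChartedSpace B M] {M' : Type*} [TopologicalSpace M']
    [ChartedSpace B' M']
    {E : M → Type*} [TopologicalSpace (TotalSpace F E)] [∀ x, AddCommGroup (E x)]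
    [∀ x, Module ℝ (E x)] [∀ x, TopologicalSpace (E x)] [FiberBundle F E]
    {E' : M' → Type*} [TopologicalSpace (TotalSpace F' E')] [∀ x, AddCommGroup (E' x)]
    [∀ x, Module ℝ (E' x)] [∀ x, TopologicalSpace (E' x)] [FiberBundle F' E']
    (φ₀ : M → M') (φ : ∀ x, E x →ₗ[ℝ] E' (φ₀ x)) : Prop where
  base_smooth : ContMDiff 𝓘(ℝ, B) 𝓘(ℝ, B') ∞ φ₀
  base_surjective : Function.Surjective φ₀
  base_submersion : ∀ x, Function.Surjective (mfderiv 𝓘(ℝ, B) 𝓘(ℝ, B') φ₀ x)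
  base_connected_fibres : ∀ x', IsConnected (φ₀ ⁻¹' {x'})
  smooth : ContMDiff (𝓘(ℝ, B).prod 𝓘(ℝ, F)) (𝓘(ℝ, B').prod 𝓘(ℝ, F')) ∞
    (fun v : TotalSpace F E ↦ (⟨φ₀ v.1, φ v.1 v.2⟩ : TotalSpace F' E'))
  fibre_surjective : ∀ x, Function.Surjective (φ x)

/-- `K = ker φ ⊆ E`. -/
def kerFamily {φ₀ : M → M'} (φ : ∀ x, E x →ₗ[ℝ] E' (φ₀ x)) (x : M) : Submodule ℝ (E x) :=
  LinearMap.ker (φ x)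

/-- `e ∼_φ e'`: the sections `e` and `e'` are `φ`-related, `φ ∘ e = e' ∘ φ₀`. -/
def Related {φ₀ : M → M'} (φ : ∀ x, E x →ₗ[ℝ] E' (φ₀ x)) (e : Sec B F E) (e' : Sec B' F' E') :
    Prop :=
  ∀ x, φ x (e x) = e' (φ₀ x)

/-- The defining property of the flat `T^{φ₀}M`-connection `∇^φ` on `E/ker φ` induced by `φ`:
`∇^φ_Y ē = 0` for every section `e` of `E` that is `φ`-related to some section of `E'`. -/
def IsInducedConnection (B' F' : Type*) [NormedAddCommGroup B'] [NormedSpace ℝ B']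
    [NormedAddCommGroup F'] [NormedSpace ℝ F']
    {M' : Type*} [TopologicalSpace M'] [ChartedSpace B' M']
    {E' : M' → Type*} [TopologicalSpace (TotalSpace F' E')] [∀ x, AddCommGroup (E' x)]
    [∀ x, Module ℝ (E' x)] [∀ x, TopologicalSpace (E' x)] [FiberBundle F' E']
    {φ₀ : M → M'} (φ : ∀ x, E x →ₗ[ℝ] E' (φ₀ x)) {FM : InvolutiveFamily B M}
    (D : FlatPartialConnection B F FM (kerFamily φ)) : Prop :=
  ∀ (Y : FM.Γ) (e : Sec B F E),
    (∃ e' : Sec B' F' E', Related φ e e') → D Y (QuotSec.proj (kerFamily φ) e) = 0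

end Fibrations

end FlatFibration

end

set_option linter.unusedSectionVars false

/-! The proof constructs a connection `C` on `E` and a connection `C'` on `E'` that are compatible
with `φ`: if `e` is `φ`-related to `e'`, then `φ(∇_v e) = ∇'_{Tφ₀ v} e'`. To get them, flat local
connections on `E'` are glued by a partition of unity. Trivializations and weights are pulled back
to `φ₀^!E'`, and the resulting connection is lifted to `E` through a smooth splitting of `φ^! : E →
φ₀^!E'` (`exists_related_connections`).

Compatibility has immediate consequences. Sections of `K = ker φ` are those related to `0`, so `C`
preserves `Γ(K)`. If `Y` is vertical and `e` is related to some `e'`, then `∇_Y e ∈ Γ(K)`. Hence `C`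
induces an `F_M`-connection on `E/K` that kills the classes of related sections. If moreover `X`
projects to a vector field on `M'`, then all three terms of `R(Y, X)e` lie in `Γ(K)`: `∇_X e` is
again related, `∇_Y e` is already in `Γ(K)`, and `[Y, X]` is vertical (`curv_mem_of_related`).

What turns this into a statement about all sections is generation. Up to a cutoff equal to one at a
chosen point, every section of `E/K` is a `C^∞(M)`-combination of classes of related sections, so a
`C^∞(M)`-linear map that kills these classes is zero (`linearMap_eq_zero`). The same principle for
the fibration `Tφ₀ : TM → TM'` says that projectable fields generate `Γ(TM/F_M)`.

Applied to the difference of two induced connections, the principle gives uniqueness. Applied to the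
curvature in `e`, with `X` vertical and thus related to `0`, it gives flatness. Applied in both `e`
and `X`, it shows that `ω_∇` vanishes identically for this `C`. For any other extension, `ω` changes
by `d_∇` of the difference tensor (`d0_differenceForm`), so its class is zero too. -/

noncomputable section

namespace FlatFibration

/-! ### Testing smoothness of bundle maps on sections -/

section HomBundle

variable {B : Type*} [NormedAddCommGroup B] [NormedSpace ℝ B]
  {M : Type*} [TopologicalSpace M] [ChartedSpace B M]
  {F : Type*} [NormedAddCommGroup F] [NormedSpace ℝ F]
  {E : M → Type*} [TopologicalSpace (TotalSpace F E)] [∀ x, AddCommGroup (E x)]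
  [∀ x, Module ℝ (E x)] [∀ x, TopologicalSpace (E x)] [FiberBundle F E] [VectorBundle ℝ F E]
  {F₂ : Type*} [NormedAddCommGroup F₂] [NormedSpace ℝ F₂]
  {V : M → Type*} [TopologicalSpace (TotalSpace F₂ V)] [∀ x, AddCommGroup (V x)]
  [∀ x, Module ℝ (V x)] [∀ x, TopologicalSpace (V x)] [FiberBundle F₂ V] [VectorBundle ℝ F₂ V]

/-- A map into `F →L[ℝ] F₂` with `F` finite-dimensional is smooth if its evaluations are. -/
theorem contMDiffAt_clm_of_apply [FiniteDimensional ℝ F] {T : M → F →L[ℝ] F₂} {x₀ : M}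
    (hT : ∀ w, ContMDiffAt 𝓘(ℝ, B) 𝓘(ℝ, F₂) ∞ (fun x ↦ T x w) x₀) :
    ContMDiffAt 𝓘(ℝ, B) 𝓘(ℝ, F →L[ℝ] F₂) ∞ T x₀ := by
  let b := Module.finBasis ℝ F
  -- Expansion in a basis: `T x` is the sum of the rank-one maps `w ↦ b.coord i w • T x (b i)`, each
  -- depending linearly on `T x (b i)`.
  have h : T = fun x ↦ ∑ i, ContinuousLinearMap.smulRightL ℝ F F₂
      (LinearMap.toContinuousLinearMap (b.coord i)) (T x (b i)) := by
    funext x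
    ext w
    conv_lhs => rw [← b.sum_repr w, map_sum]
    simp
  rw [h]
  exact contMDiffAt_finsetSum fun i _ ↦
    (ContinuousLinearMap.contMDiff _).contMDiffAt.comp x₀ (hT (b i))

theorem contMDiffOn_symm [ContMDiffVectorBundle ∞ F E 𝓘(ℝ, B)]
    (e : Trivialization F (π F E)) [MemTrivializationAtlas e] {g : M → F}
    {U : Set M} (hU : IsOpen U) (hUe : U ⊆ e.baseSet)
    (hg : ContMDiffOn 𝓘(ℝ, B) 𝓘(ℝ, F) ∞ g U) :
    ContMDiffOn 𝓘(ℝ, B) (𝓘(ℝ, B).prod 𝓘(ℝ, F)) ∞ 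
      (fun x ↦ TotalSpace.mk' F x (e.symm x (g x))) U :=
  (e.contMDiffOn_section_iff hU hUe).2 (hg.congr fun x hx ↦ by
    rw [e.apply_mk_symm (hUe hx)])

variable [FiniteDimensional ℝ B] [T2Space M] [IsManifold 𝓘(ℝ, B) ∞ M]

theorem exists_fn_eventually_eq_one {U : Set M} {x₀ : M} (hU : U ∈ 𝓝 x₀) :
    ∃ χ : Fn B M, (∀ᶠ x in 𝓝 x₀, χ x = 1) ∧ tsupport χ ⊆ U := by
  obtain ⟨f, -, hf⟩ := (SmoothBumpFunction.nhds_basis_tsupport (I := 𝓘(ℝ, B)) x₀).mem_iff.1 hU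
  exact ⟨⟨f, f.contMDiff⟩, f.eventuallyEq_one, hf⟩

variable [ContMDiffVectorBundle ∞ F E 𝓘(ℝ, B)]

/-- A vector of the typical fibre extends, in a given trivialization, to a global section that is
constant near `x₀`. -/
theorem exists_sec_eventually_eq_symm
    (e : Trivialization F (π F E)) [MemTrivializationAtlas e] {x₀ : M} (hx₀ : x₀ ∈ e.baseSet)
    (w : F) : ∃ s : Sec B F E, ∀ᶠ x in 𝓝 x₀, s x = e.symm x w := by
  obtain ⟨χ, h1, h2⟩ := exists_fn_eventually_eq_one (B := B) (e.open_baseSet.mem_nhds hx₀)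
  refine ⟨⟨fun x ↦ χ x • e.symm x w, ContMDiffOn.smul_section_of_tsupport χ.contMDiff.contMDiffOn
    e.open_baseSet h2 (contMDiffOn_symm e e.open_baseSet subset_rfl contMDiffOn_const)⟩, ?_⟩
  filter_upwards [h1] with x hx
  exact (congrArg (· • e.symm x w) hx).trans (one_smul ℝ _)

/-- A family of linear maps `E x → V x` is smooth at `x₀` if it maps global sections to sections
that are smooth at `x₀`. -/
theorem contMDiffAt_hom_of_apply [FiniteDimensional ℝ F]
    [∀ x, IsTopologicalAddGroup (V x)] [∀ x, ContinuousSMul ℝ (V x)]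
    [ContMDiffVectorBundle ∞ F₂ V 𝓘(ℝ, B)]
    {L : ∀ x, E x →L[ℝ] V x} {x₀ : M}
    (hL : ∀ s : Sec B F E, ContMDiffAt 𝓘(ℝ, B) (𝓘(ℝ, B).prod 𝓘(ℝ, F₂)) ∞
      (fun x ↦ TotalSpace.mk' F₂ x (L x (s x))) x₀) :
    ContMDiffAt 𝓘(ℝ, B) (𝓘(ℝ, B).prod 𝓘(ℝ, F →L[ℝ] F₂)) ∞
      (fun x ↦ TotalSpace.mk' (F →L[ℝ] F₂) (E := fun x ↦ E x →L[ℝ] V x) x (L x)) x₀ := by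
  rw [contMDiffAt_hom_bundle]
  refine ⟨contMDiffAt_id, contMDiffAt_clm_of_apply fun w ↦ ?_⟩
  have hE := mem_baseSet_trivializationAt F E x₀
  have hV := mem_baseSet_trivializationAt F₂ V x₀
  obtain ⟨s, hs⟩ := exists_sec_eventually_eq_symm (B := B) (trivializationAt F E x₀) hE w
  -- Near `x₀` the section `s` has constant coordinate `w`, so the coordinate of `L x (s x)` is the
  -- local representative of `L` evaluated at `w`.
  refine (((trivializationAt F₂ V x₀).contMDiffAt_section_iff hV).1 (hL s)).congr_of_eventuallyEq ?_
  filter_upwards [hs, (trivializationAt F E x₀).open_baseSet.mem_nhds hE,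
    (trivializationAt F₂ V x₀).open_baseSet.mem_nhds hV] with x hx h1 h2
  simp [ContinuousLinearMap.inCoordinates, hx, Trivialization.coe_linearMapAt_of_mem _ h2,
    Trivialization.symmL_apply _ h1]

end HomBundle

/-! ### Connections glued from local trivializations -/

section Gluing

/-- A family of local trivializations of a vector bundle with a subordinate smooth partition of
unity. -/
structure TrivializationPartition (B : Type*) [NormedAddCommGroup B] [NormedSpace ℝ B] {M : Type*}
    [TopologicalSpace M] [ChartedSpace B M] (F : Type*) [NormedAddCommGroup F] [NormedSpace ℝ F]
    (E : M → Type*) [TopologicalSpace (TotalSpace F E)] [∀ x, TopologicalSpace (E x)]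
    [FiberBundle F E] (ι : Type*) where
  /-- the trivializations -/
  triv : ι → Trivialization F (π F E)
  mem_atlas : ∀ j, MemTrivializationAtlas (triv j)
  /-- the partition of unity -/
  weight : ι → Fn B M
  locallyFinite : LocallyFinite fun j ↦ Function.support (weight j)
  sum_eq_one : ∀ x, ∑ᶠ j, weight j x = 1
  subordinate : ∀ j, tsupport (weight j) ⊆ (triv j).baseSet

attribute [instance] TrivializationPartition.mem_atlas

variable {B : Type*} [NormedAddCommGroup B] [NormedSpace ℝ B]
  {M : Type*} [TopologicalSpace M] [ChartedSpace B M]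
  {F : Type*} [NormedAddCommGroup F] [NormedSpace ℝ F]
  {E : M → Type*} [TopologicalSpace (TotalSpace F E)] [∀ x, AddCommGroup (E x)]
  [∀ x, Module ℝ (E x)] [∀ x, TopologicalSpace (E x)] [FiberBundle F E] [VectorBundle ℝ F E]

theorem mvfderiv_congr {f g : M → F} {x : M} (h : f =ᶠ[𝓝 x] g) :
    mvfderiv 𝓘(ℝ, B) f x = mvfderiv 𝓘(ℝ, B) g x := by
  ext v
  exact congrArg (fun l ↦ l v) (h.mfderiv_eq (I := 𝓘(ℝ, B)) (I' := 𝓘(ℝ, F)))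

/-- The derivative along a vector field of a function that is smooth on an open set. -/
theorem contMDiffOn_mvfderiv_apply [FiniteDimensional ℝ B] [T2Space M] [IsManifold 𝓘(ℝ, B) ∞ M]
    {f : M → F} {U : Set M} (hU : IsOpen U) (hf : ContMDiffOn 𝓘(ℝ, B) 𝓘(ℝ, F) ∞ f U)
    (X : VecField B M) :
    ContMDiffOn 𝓘(ℝ, B) 𝓘(ℝ, F) ∞ (fun x ↦ mvfderiv 𝓘(ℝ, B) f x (X x)) U := by
  intro x₀ hx₀
  obtain ⟨χ, h1, h2⟩ := exists_fn_eventually_eq_one (B := B) (hU.mem_nhds hx₀)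
  -- The cutoff makes the function globally smooth, so that its tangent map is smooth. Since `χ` is
  -- one on a whole neighbourhood of every point near `x₀`, the derivatives are unchanged there.
  have hg : ContMDiff 𝓘(ℝ, B) 𝓘(ℝ, F) ∞ (fun x ↦ χ x • f x) :=
    contMDiff_of_tsupport fun x hx ↦ χ.contMDiff.contMDiffAt.smul
      (hf.contMDiffAt (hU.mem_nhds (h2 (tsupport_smul_subset_left _ _ hx))))
  have h3 : ContMDiff 𝓘(ℝ, B).tangent 𝓘(ℝ, F).tangent ∞
      (tangentMap 𝓘(ℝ, B) 𝓘(ℝ, F) (fun x ↦ χ x • f x)) := hg.contMDiff_tangentMap (by simp)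
  refine ContMDiffAt.contMDiffWithinAt <| ContMDiffAt.congr_of_eventuallyEq
    (((contMDiff_snd_tangentBundle_modelSpace F 𝓘(ℝ, F)).comp (h3.comp X.contMDiff)).contMDiffAt) ?_
  filter_upwards [h1.eventually_nhds] with x hx
  have : f =ᶠ[𝓝 x] fun x ↦ χ x • f x := by
    filter_upwards [hx] with y hy
    rw [hy, one_smul]
  rw [mvfderiv_congr this]
  rfl

/-- The flat covariant derivative of the frame given by a local trivialization. -/
def localCov (e : Trivialization F (π F E)) [MemTrivializationAtlas e] (s : ∀ x, E x) (x : M) :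
    TangentSpace 𝓘(ℝ, B) x →L[ℝ] E x :=
  (e.symmL ℝ x).comp (mvfderiv 𝓘(ℝ, B) (fun y ↦ (e ⟨y, s y⟩).2) x)


variable [ContMDiffVectorBundle ∞ F E 𝓘(ℝ, B)]
  (e : Trivialization F (π F E)) [MemTrivializationAtlas e] {s t : ∀ x, E x} {x : M}

theorem localCov_add [∀ x, IsTopologicalAddGroup (E x)] (hx : x ∈ e.baseSet)
    (hs : MDifferentiableAt 𝓘(ℝ, B) (𝓘(ℝ, B).prod 𝓘(ℝ, F)) (fun y ↦ TotalSpace.mk' F y (s y)) x)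
    (ht : MDifferentiableAt 𝓘(ℝ, B) (𝓘(ℝ, B).prod 𝓘(ℝ, F)) (fun y ↦ TotalSpace.mk' F y (t y)) x) :
    localCov (B := B) e (s + t) x = localCov e s x + localCov e t x := by
  rw [e.mdifferentiableAt_section_iff 𝓘(ℝ, B) _ hx] at hs ht
  have h : (fun y ↦ (e ⟨y, (s + t) y⟩).2) =ᶠ[𝓝 x]
      (fun y ↦ (e ⟨y, s y⟩).2) + fun y ↦ (e ⟨y, t y⟩).2 := by
    filter_upwards [e.open_baseSet.mem_nhds hx] with y hy
    exact (e.linear ℝ hy).map_add _ _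
  rw [localCov, localCov, localCov, mvfderiv_congr h, mvfderiv_add hs ht,
    ContinuousLinearMap.comp_add]

theorem localCov_smul [∀ x, IsTopologicalAddGroup (E x)] [∀ x, ContinuousSMul ℝ (E x)] {g : M → ℝ}
    (hx : x ∈ e.baseSet)
    (hs : MDifferentiableAt 𝓘(ℝ, B) (𝓘(ℝ, B).prod 𝓘(ℝ, F)) (fun y ↦ TotalSpace.mk' F y (s y)) x)
    (hg : MDifferentiableAt 𝓘(ℝ, B) 𝓘(ℝ) g x) :
    localCov (B := B) e (g • s) x =
      g x • localCov e s x + (mvfderiv 𝓘(ℝ, B) g x).smulRight (s x) := by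
  rw [e.mdifferentiableAt_section_iff 𝓘(ℝ, B) _ hx] at hs
  have h : (fun y ↦ (e ⟨y, (g • s) y⟩).2) =ᶠ[𝓝 x] g • (fun y ↦ (e ⟨y, s y⟩).2) := by
    filter_upwards [e.open_baseSet.mem_nhds hx] with y hy
    exact (e.linear ℝ hy).map_smul _ _
  ext v
  rw [localCov, mvfderiv_congr h, mvfderiv_smul hg hs]
  simp [localCov, map_smul, -Trivialization.symmL_apply]
  -- The Leibniz term is a multiple of the coordinate vector of `s x`, which the inverse
  -- trivialization returns to `s x`.
  rw [e.symmL_apply hx, e.symm_apply_apply_mk hx]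

theorem contMDiffOn_localCov_apply [FiniteDimensional ℝ B] [T2Space M] [IsManifold 𝓘(ℝ, B) ∞ M]
    (s : Sec B F E) (X : VecField B M) :
    ContMDiffOn 𝓘(ℝ, B) (𝓘(ℝ, B).prod 𝓘(ℝ, F)) ∞
      (fun x ↦ TotalSpace.mk' F x (localCov e s x (X x))) e.baseSet := by
  have h := (e.contMDiffOn_section_baseSet_iff (n := ∞) (IB := 𝓘(ℝ, B))).1 s.contMDiff.contMDiffOn
  refine (contMDiffOn_symm e e.open_baseSet subset_rfl
    (contMDiffOn_mvfderiv_apply e.open_baseSet h X)).congr fun x hx ↦ ?_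
  rw [localCov, ContinuousLinearMap.comp_apply, e.symmL_apply hx]

namespace TrivializationPartition

variable {ι : Type*} (P : TrivializationPartition B F E ι)

theorem mem_baseSet {j : ι} {x : M} (h : P.weight j x ≠ 0) : x ∈ (P.triv j).baseSet :=
  P.subordinate j (subset_tsupport _ h)

variable [∀ x, IsTopologicalAddGroup (E x)] [∀ x, ContinuousSMul ℝ (E x)]

/-- The covariant derivative obtained by gluing the local flat ones. -/
def gluedCov (s : ∀ x, E x) (x : M) : TangentSpace 𝓘(ℝ, B) x →L[ℝ] E x :=
  ∑ᶠ j, P.weight j x • localCov (P.triv j) s x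

theorem gluedCov_eq_sum (s : ∀ x, E x) (x : M) : P.gluedCov s x =
    ∑ j ∈ (P.locallyFinite.point_finite x).toFinset, P.weight j x • localCov (P.triv j) s x :=
  finsum_eq_sum_of_support_subset _ fun j hj ↦ by
    simpa using left_ne_zero_of_smul (Function.mem_support.1 hj)

theorem gluedCov_apply_eq_sum (s : ∀ x, E x) (x : M) (v : TangentSpace 𝓘(ℝ, B) x) :
    P.gluedCov s x v =
      ∑ j ∈ (P.locallyFinite.point_finite x).toFinset, P.weight j x • localCov (P.triv j) s x v := by
  rw [gluedCov_eq_sum]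
  simp

/-- Connections form an affine space, so a combination with weights of sum one is again a
connection. Each `localCov` is a connection only over its base set, but an index with nonzero weight
at `x` has `x` in its base set. -/
theorem isCovariantDerivativeOn_gluedCov :
    IsCovariantDerivativeOn F (I := 𝓘(ℝ, B)) P.gluedCov univ where
  add {s t x} hs ht _ := by
    rw [gluedCov_eq_sum, gluedCov_eq_sum, gluedCov_eq_sum, ← Finset.sum_add_distrib]
    refine Finset.sum_congr rfl fun j hj ↦ ?_
    rw [localCov_add _ (P.mem_baseSet (by simpa using hj)) hs ht, smul_add]
  leibniz {s g x} hs hg _ := by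
    have h : ∑ j ∈ (P.locallyFinite.point_finite x).toFinset, P.weight j x = 1 := by
      rw [← P.sum_eq_one x]
      exact (finsum_eq_sum_of_support_subset _ fun j hj ↦ by simpa using hj).symm
    -- The single Leibniz term is spread over the sum by writing its coefficient one as the sum of
    -- the weights; the identity then holds summand by summand.
    rw [gluedCov_eq_sum, gluedCov_eq_sum,
      ← one_smul ℝ ((mvfderiv 𝓘(ℝ, B) g x).smulRight (s x)), ← h,
      Finset.sum_smul, Finset.smul_sum, ← Finset.sum_add_distrib]
    refine Finset.sum_congr rfl fun j hj ↦ ?_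
    rw [localCov_smul _ (P.mem_baseSet (by simpa using hj)) hs hg, smul_add, smul_comm]

theorem contMDiff_gluedCov_apply [FiniteDimensional ℝ B] [T2Space M] [IsManifold 𝓘(ℝ, B) ∞ M]
    (s : Sec B F E) (X : VecField B M) :
    ContMDiff 𝓘(ℝ, B) (𝓘(ℝ, B).prod 𝓘(ℝ, F)) ∞
      (fun x ↦ TotalSpace.mk' F x (P.gluedCov s x (X x))) := by
  have h : ∀ x, P.gluedCov s x (X x) =
      ∑ᶠ j, P.weight j x • localCov (P.triv j) s x (X x) := fun x ↦ by
    rw [gluedCov_apply_eq_sum, finsum_eq_sum_of_support_subset _ fun j hj ↦ ?_]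
    simpa using left_ne_zero_of_smul (Function.mem_support.1 hj)
  simp only [h]
  refine ContMDiff.finsum_section_of_locallyFinite (P.locallyFinite.subset fun j x hx ↦
    left_ne_zero_of_smul hx) fun j ↦ ?_
  exact ContMDiffOn.smul_section_of_tsupport (P.weight j).contMDiff.contMDiffOn
    (P.triv j).open_baseSet (P.subordinate j) (contMDiffOn_localCov_apply _ s X)

end TrivializationPartition

section LinearConnection

variable [FiniteDimensional ℝ B] [T2Space M] [IsManifold 𝓘(ℝ, B) ∞ M]
  [∀ x, IsTopologicalAddGroup (E x)] [∀ x, ContinuousSMul ℝ (E x)]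

/-- A covariant derivative is smooth if it maps smooth vector fields and smooth sections to smooth
sections. -/
def LinearConnection.ofApply (C : CovariantDerivative 𝓘(ℝ, B) F E)
    (h : ∀ (s : Sec B F E) (X : VecField B M), ContMDiff 𝓘(ℝ, B) (𝓘(ℝ, B).prod 𝓘(ℝ, F)) ∞
      (fun x ↦ TotalSpace.mk' F x (C s x (X x)))) : LinearConnection B F E where
  cov := C
  smooth := ⟨⟨fun {s} hs ↦ by
    -- The derivative of `s` is a section of `Hom(TM, E)`, so global vector fields suffice as test
    -- sections.
    exact fun x _ ↦ (contMDiffAt_hom_of_apply fun X ↦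
      (h ⟨s, by simpa using contMDiffOn_univ.1 hs⟩ X).contMDiffAt).contMDiffWithinAt⟩⟩

/-- The glued linear connection. -/
def TrivializationPartition.connection {ι : Type*} (P : TrivializationPartition B F E ι) :
    LinearConnection B F E :=
  .ofApply ⟨P.gluedCov, P.isCovariantDerivativeOn_gluedCov⟩ P.contMDiff_gluedCov_apply

variable (B F E) in
theorem exists_trivializationPartition [SigmaCompactSpace M] :
    Nonempty (TrivializationPartition B F E M) := by
  obtain ⟨ρ, hρ⟩ := SmoothPartitionOfUnity.exists_isSubordinate 𝓘(ℝ, B) (isClosed_univ (X := M))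
    (fun x ↦ (trivializationAt F E x).baseSet) (fun x ↦ (trivializationAt F E x).open_baseSet)
    (fun x _ ↦ mem_iUnion_of_mem x (mem_baseSet_trivializationAt F E x))
  exact ⟨{ triv := trivializationAt F E
           mem_atlas := inferInstance
           weight := ρ
           locallyFinite := ρ.locallyFinite
           sum_eq_one := fun x ↦ ρ.sum_eq_one (mem_univ x)
           subordinate := hρ }⟩

end LinearConnection

end Gluing

/-! ### Splittings of surjective morphisms and lifts of connections -/

section Splitting

variable {B : Type*} [NormedAddCommGroup B] [NormedSpace ℝ B] [FiniteDimensional ℝ B]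
  {M : Type*} [TopologicalSpace M] [ChartedSpace B M] [IsManifold 𝓘(ℝ, B) ∞ M]
  [T2Space M] [SigmaCompactSpace M]
  {F : Type*} [NormedAddCommGroup F] [NormedSpace ℝ F] [FiniteDimensional ℝ F]
  {E : M → Type*} [TopologicalSpace (TotalSpace F E)] [∀ x, AddCommGroup (E x)]
  [∀ x, Module ℝ (E x)] [∀ x, TopologicalSpace (E x)] [FiberBundle F E] [VectorBundle ℝ F E]
  [∀ x, IsTopologicalAddGroup (E x)] [∀ x, ContinuousSMul ℝ (E x)]
  [ContMDiffVectorBundle ∞ F E 𝓘(ℝ, B)]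
  {F₂ : Type*} [NormedAddCommGroup F₂] [NormedSpace ℝ F₂] [FiniteDimensional ℝ F₂]
  {V : M → Type*} [TopologicalSpace (TotalSpace F₂ V)] [∀ x, AddCommGroup (V x)]
  [∀ x, Module ℝ (V x)] [∀ x, TopologicalSpace (V x)] [FiberBundle F₂ V] [VectorBundle ℝ F₂ V]
  [∀ x, IsTopologicalAddGroup (V x)] [∀ x, ContinuousSMul ℝ (V x)]
  [ContMDiffVectorBundle ∞ F₂ V 𝓘(ℝ, B)]

/-- A smooth family of linear maps that is surjective at `x₀` has a smooth family of right inverses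
near `x₀`. -/
theorem exists_smooth_rightInverse_near {Φ : M → F →L[ℝ] F₂} {U : Set M} {x₀ : M} (hU : U ∈ 𝓝 x₀)
    (hΦ : ContMDiffOn 𝓘(ℝ, B) 𝓘(ℝ, F →L[ℝ] F₂) ∞ Φ U) (h₀ : Function.Surjective (Φ x₀)) :
    ∃ R : M → F₂ →L[ℝ] F, ∃ W ∈ 𝓝 x₀, W ⊆ U ∧ ContMDiffOn 𝓘(ℝ, B) 𝓘(ℝ, F₂ →L[ℝ] F) ∞ R W ∧
      ∀ x ∈ W, (Φ x).comp (R x) = .id ℝ F₂ := by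
  have := FiniteDimensional.complete ℝ F₂
  obtain ⟨S, hS⟩ := (Φ x₀).toLinearMap.exists_rightInverse_of_surjective
    (LinearMap.range_eq_top.2 h₀)
  let R₀ : F₂ →L[ℝ] F := LinearMap.toContinuousLinearMap S
  -- A right inverse `R₀` at `x₀` is kept fixed. `G` is the identity at `x₀`, hence invertible
  -- nearby, and `R₀ ∘ G⁻¹` corrects `R₀` to a right inverse at the neighbouring points.
  let G : M → F₂ →L[ℝ] F₂ := fun x ↦ (Φ x).comp R₀
  have hG : ContMDiffOn 𝓘(ℝ, B) 𝓘(ℝ, F₂ →L[ℝ] F₂) ∞ G U := hΦ.clm_comp contMDiffOn_const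
  have hG₀ : G x₀ = 1 := by
    ext v
    exact LinearMap.congr_fun hS v
  refine ⟨fun x ↦ R₀.comp (Ring.inverse (G x)), U ∩ G ⁻¹' {T | IsUnit T}, inter_mem hU ?_,
    inter_subset_left, ?_, ?_⟩
  · refine (hG.continuousOn.continuousAt hU).preimage_mem_nhds (Units.isOpen.mem_nhds ?_)
    simp [hG₀]
  · refine contMDiffOn_const.clm_comp fun x hx ↦ ?_
    obtain ⟨u, hu⟩ := hx.2
    have h1 : ContDiffAt ℝ ∞ Ring.inverse (G x) := by
      rw [← hu]
      exact contDiffAt_ringInverse ℝ u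
    exact h1.contMDiffAt.comp_contMDiffWithinAt x (hG.mono inter_subset_left x hx)
  · intro x hx
    exact Ring.mul_inverse_cancel _ hx.2

/-- A smooth surjective morphism of vector bundles over the identity splits. -/
theorem exists_splitting {L : ∀ x, E x →L[ℝ] V x}
    (hL : ContMDiff 𝓘(ℝ, B) (𝓘(ℝ, B).prod 𝓘(ℝ, F →L[ℝ] F₂)) ∞
      (fun x ↦ TotalSpace.mk' (F →L[ℝ] F₂) (E := fun x ↦ E x →L[ℝ] V x) x (L x)))
    (hs : ∀ x, Function.Surjective (L x)) :
    ∃ σ : Cₛ^∞⟮𝓘(ℝ, B); F₂ →L[ℝ] F, fun x ↦ V x →L[ℝ] E x⟯, ∀ x v, L x (σ x v) = v := by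
  -- The right inverses of `L x` form a convex set, so local smooth splittings can be averaged by a
  -- partition of unity.
  refine exists_contMDiffSection_forall_mem_convex_of_local 𝓘(ℝ, B) (n := ⊤)
    (F_fiber := F₂ →L[ℝ] F) (fun x ↦ V x →L[ℝ] E x) (fun x ↦ {T | ∀ v, L x (T v) = v})
    (fun x T hT T' hT' a b _ _ hab v ↦ ?_) fun x₀ ↦ ?_
  · change L x (a • T v + b • T' v) = v
    rw [map_add, map_smul, map_smul, hT, hT', ← add_smul, hab, one_smul]
  have hE := mem_baseSet_trivializationAt F E x₀
  have hV := mem_baseSet_trivializationAt F₂ V x₀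
  set e := trivializationAt F E x₀
  set e₂ := trivializationAt F₂ V x₀
  have hU := inter_mem (e.open_baseSet.mem_nhds hE) (e₂.open_baseSet.mem_nhds hV)
  obtain ⟨R, W, hW, hWU, hR, hRi⟩ := exists_smooth_rightInverse_near (B := B)
    (Φ := fun x ↦ (e₂.continuousLinearMapAt ℝ x).comp ((L x).comp (e.symmL ℝ x))) hU
    (fun x hx ↦ ContMDiffAt.contMDiffWithinAt <| contMDiffAt_clm_of_apply fun w ↦ by
      have h1 := (contMDiffOn_symm (B := B) e e.open_baseSet subset_rfl
        (contMDiffOn_const (c := w))).contMDiffAt (e.open_baseSet.mem_nhds hx.1)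
      have h2 := (e₂.contMDiffAt_section_iff hx.2).1 (ContMDiffAt.clm_bundle_apply (hL x) h1)
      refine h2.congr_of_eventuallyEq ?_
      filter_upwards [e.open_baseSet.mem_nhds hx.1, e₂.open_baseSet.mem_nhds hx.2] with y h1 h2
      simp [Trivialization.coe_linearMapAt_of_mem _ h2, Trivialization.symmL_apply _ h1])
    (fun w ↦ by
      obtain ⟨a, ha⟩ := hs x₀ (e₂.symmL ℝ x₀ w)
      refine ⟨e.continuousLinearMapAt ℝ x₀ a, ?_⟩
      rw [ContinuousLinearMap.comp_apply, ContinuousLinearMap.comp_apply,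
        e.symmL_continuousLinearMapAt hE, ha, e₂.continuousLinearMapAt_symmL hV])
  refine ⟨interior W, interior_mem_nhds.2 hW, fun x ↦ (e.symmL ℝ x).comp
    ((R x).comp (e₂.continuousLinearMapAt ℝ x)), fun x hx ↦ ?_, fun x hx v ↦ ?_⟩
  · refine ContMDiffAt.contMDiffWithinAt <| contMDiffAt_hom_of_apply fun s ↦ ?_
    have hx' := hWU (interior_subset hx)
    have h1 := (e₂.contMDiffAt_section_iff hx'.2).1 (s.contMDiff (x := x))
    have h2 := (hR.contMDiffAt (mem_interior_iff_mem_nhds.1 hx)).clm_apply h1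
    refine (e.contMDiffAt_section_iff hx'.1).2 (h2.congr_of_eventuallyEq ?_)
    filter_upwards [e.open_baseSet.mem_nhds hx'.1, e₂.open_baseSet.mem_nhds hx'.2] with y h1 h2
    simp [Trivialization.coe_linearMapAt_of_mem _ h2, Trivialization.symmL_apply _ h1,
      e.apply_mk_symm h1]
  · have hx' := interior_subset hx
    have h := congrArg (fun T ↦ e₂.symmL ℝ x (T (e₂.continuousLinearMapAt ℝ x v))) (hRi x hx')
    simpa [(hWU hx').2, Trivialization.symmL_continuousLinearMapAt _ (hWU hx').2] using h

omit [SigmaCompactSpace M] [FiniteDimensional ℝ F] [FiniteDimensional ℝ F₂] in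
theorem LinearConnection.contMDiff_cov_apply (C : LinearConnection B F E)
    (s : Sec B F E) (X : VecField B M) : ContMDiff 𝓘(ℝ, B) (𝓘(ℝ, B).prod 𝓘(ℝ, F)) ∞
      (fun x ↦ TotalSpace.mk' F x (C.cov s x (X x))) :=
  (C.nabla X s).contMDiff

/-- Along a smooth surjective morphism `L : E → V`, every linear connection on `V` lifts to `E`. -/
theorem exists_lift_connection {L : ∀ x, E x →L[ℝ] V x}
    (hL : ContMDiff 𝓘(ℝ, B) (𝓘(ℝ, B).prod 𝓘(ℝ, F →L[ℝ] F₂)) ∞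
      (fun x ↦ TotalSpace.mk' (F →L[ℝ] F₂) (E := fun x ↦ E x →L[ℝ] V x) x (L x)))
    (hs : ∀ x, Function.Surjective (L x)) (W : LinearConnection B F₂ V) :
    ∃ C : LinearConnection B F E, ∀ (s : ∀ x, E x) x v,
      L x (C.cov s x v) = W.cov (fun y ↦ L y (s y)) x v := by
  obtain ⟨σ, hσ⟩ := exists_splitting hL hs
  obtain ⟨P⟩ := exists_trivializationPartition B F E
  let C₀ := P.connection.cov
  -- `D` measures how far an auxiliary connection `C₀` on `E` fails to lift `W`. Its two Leibniz
  -- terms cancel, so it is tensorial on differentiable sections; adding `σ ∘ D` to `C₀` therefore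
  -- gives a connection, and `L ∘ σ = id` removes the defect.
  let D : (∀ x, E x) → ∀ x, TangentSpace 𝓘(ℝ, B) x →L[ℝ] V x := fun s x ↦
    W.cov (fun y ↦ L y (s y)) x - (L x).comp (C₀ s x)
  have hd {s : ∀ x, E x} {x : M} (h : MDifferentiableAt 𝓘(ℝ, B) (𝓘(ℝ, B).prod 𝓘(ℝ, F))
      (fun y ↦ TotalSpace.mk' F y (s y)) x) : MDifferentiableAt 𝓘(ℝ, B) (𝓘(ℝ, B).prod 𝓘(ℝ, F₂))
      (fun y ↦ TotalSpace.mk' F₂ y (L y (s y))) x :=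
    ((hL x).mdifferentiableAt (by simp)).clm_bundle_apply h
  let C : CovariantDerivative 𝓘(ℝ, B) F E :=
    { toFun := fun s x ↦ C₀ s x + (σ x).comp (D s x)
      isCovariantDerivativeOnUniv :=
        { add := fun {s t x} hs ht _ ↦ by
            have h1 := C₀.isCovariantDerivativeOnUniv.add hs ht
            have h2 := W.cov.isCovariantDerivativeOnUniv.add (hd hs) (hd ht)
            have h3 : (fun y ↦ L y ((s + t) y)) = (fun y ↦ L y (s y)) + fun y ↦ L y (t y) :=
              funext fun y ↦ map_add (L y) _ _
            ext v
            simp only [D, h1, h3, h2, _root_.add_apply, ContinuousLinearMap.comp_apply,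
              _root_.sub_apply, map_add, map_sub]
            abel
          leibniz := fun {s g x} hs hg _ ↦ by
            have h1 := C₀.isCovariantDerivativeOnUniv.leibniz hs hg
            have h2 := W.cov.isCovariantDerivativeOnUniv.leibniz (hd hs) hg
            have h3 : (fun y ↦ L y ((g • s) y)) = g • fun y ↦ L y (s y) :=
              funext fun y ↦ map_smul (L y) _ _
            ext v
            simp only [D, h1, h3, h2, _root_.add_apply, ContinuousLinearMap.comp_apply,
              _root_.sub_apply, _root_.smul_apply,
              ContinuousLinearMap.smulRight_apply, map_add, map_sub, map_smul, smul_add, smul_sub]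
            abel } }
  refine ⟨.ofApply C fun s X ↦ ?_, fun s x v ↦ ?_⟩
  · have h1 : ContMDiff 𝓘(ℝ, B) (𝓘(ℝ, B).prod 𝓘(ℝ, F)) ∞
        (fun x ↦ TotalSpace.mk' F x (C₀ s x (X x))) := P.connection.contMDiff_cov_apply s X
    have h2 := W.contMDiff_cov_apply ⟨_, hL.clm_bundle_apply s.contMDiff⟩ X
    have h3 := h2.sub_section (hL.clm_bundle_apply h1)
    exact h1.add_section (σ.contMDiff.clm_bundle_apply h3)
  · change L x (C₀ s x v + σ x (W.cov (fun y ↦ L y (s y)) x v - L x (C₀ s x v))) = _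
    rw [map_add, hσ, add_sub_cancel]

end Splitting

/-! ### Pullback bundles and connections compatible with `φ` -/

section Pullback

variable {B : Type*} [NormedAddCommGroup B] [NormedSpace ℝ B]
  {M : Type*} [TopologicalSpace M] [ChartedSpace B M]
  {F : Type*} [NormedAddCommGroup F] [NormedSpace ℝ F]
  {E : M → Type*} [TopologicalSpace (TotalSpace F E)] [∀ x, AddCommGroup (E x)]
  [∀ x, Module ℝ (E x)] [∀ x, TopologicalSpace (E x)] [FiberBundle F E] [VectorBundle ℝ F E]
  {B' : Type*} [NormedAddCommGroup B'] [NormedSpace ℝ B']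
  {M' : Type*} [TopologicalSpace M'] [ChartedSpace B' M']
  {F' : Type*} [NormedAddCommGroup F'] [NormedSpace ℝ F']
  {E' : M' → Type*} [TopologicalSpace (TotalSpace F' E')] [∀ x, AddCommGroup (E' x)]
  [∀ x, Module ℝ (E' x)] [∀ x, TopologicalSpace (E' x)] [FiberBundle F' E'] [VectorBundle ℝ F' E']

instance pullbackAddCommGroup (f : M → M') (x : M) : AddCommGroup ((f *ᵖ E') x) :=
  inferInstanceAs (AddCommGroup (E' (f x)))

instance pullbackIsTopologicalAddGroup (f : M → M') (x : M) [∀ x, IsTopologicalAddGroup (E' x)] :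
    IsTopologicalAddGroup ((f *ᵖ E') x) :=
  inferInstanceAs (IsTopologicalAddGroup (E' (f x)))

instance pullbackContinuousSMul (f : M → M') (x : M) [∀ x, ContinuousSMul ℝ (E' x)] :
    ContinuousSMul ℝ ((f *ᵖ E') x) :=
  inferInstanceAs (ContinuousSMul ℝ (E' (f x)))

variable [ContMDiffVectorBundle ∞ F' E' 𝓘(ℝ, B')]
  (f : C^∞⟮𝓘(ℝ, B), M; 𝓘(ℝ, B'), M'⟯)

/-- A section of the pullback bundle is smooth if the corresponding map to the total space is. -/
theorem contMDiff_pullback_section {s : ∀ x, E' (f x)}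
    (hs : ContMDiff 𝓘(ℝ, B) (𝓘(ℝ, B').prod 𝓘(ℝ, F')) ∞ (fun x ↦ TotalSpace.mk' F' (f x) (s x))) :
    ContMDiff 𝓘(ℝ, B) (𝓘(ℝ, B).prod 𝓘(ℝ, F')) ∞
      (fun x ↦ TotalSpace.mk' F' (E := (f : M → M') *ᵖ E') x (s x)) := fun x₀ ↦
  (contMDiffAt_section x₀).2 (contMDiffAt_totalSpace.1 (hs x₀)).2

instance memTrivializationAtlas_pullback (e : Trivialization F' (π F' E'))
    [h : MemTrivializationAtlas e] : MemTrivializationAtlas (e.pullback f) :=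
  ⟨⟨e, h, rfl⟩⟩

/-- The pullback of a family of trivializations and of the subordinate partition of unity. -/
def TrivializationPartition.pullback {ι : Type*} (P : TrivializationPartition B' F' E' ι) :
    TrivializationPartition B F' ((f : M → M') *ᵖ E') ι where
  triv j := (P.triv j).pullback f
  mem_atlas _ := inferInstance
  weight j := (P.weight j).comp f
  locallyFinite := P.locallyFinite.preimage_continuous f.contMDiff.continuous
  sum_eq_one x := P.sum_eq_one (f x)
  subordinate j := (tsupport_comp_subset_preimage _ f.contMDiff.continuous).trans
    (preimage_mono (P.subordinate j))

/-- The chain rule: in the pulled-back trivialization the coordinates of `s ∘ f` are the coordinates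
of `s` composed with `f`. -/
theorem localCov_pullback [∀ x, IsTopologicalAddGroup (E' x)] [∀ x, ContinuousSMul ℝ (E' x)]
    (e : Trivialization F' (π F' E')) [MemTrivializationAtlas e] (s : Sec B' F' E') {x : M}
    (hx : f x ∈ e.baseSet) (v : TangentSpace 𝓘(ℝ, B) x) :
    localCov (E := (f : M → M') *ᵖ E') (e.pullback f) (fun x ↦ s (f x)) x v =
      localCov e s (f x) (mfderiv 𝓘(ℝ, B) 𝓘(ℝ, B') f x v) := by
  have h1 := (e.mdifferentiableAt_section_iff 𝓘(ℝ, B') _ hx).1 s.mdifferentiableAt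
  have h2 : mvfderiv 𝓘(ℝ, B) (fun y ↦ (e ⟨f y, s (f y)⟩).2) x v =
      mvfderiv 𝓘(ℝ, B') (fun y ↦ (e ⟨y, s y⟩).2) (f x) (mfderiv 𝓘(ℝ, B) 𝓘(ℝ, B') f x v) :=
    mfderiv_comp_apply x h1 (f.contMDiff.mdifferentiable (by simp) x) v
  change (e.pullback f).symmL ℝ x (mvfderiv 𝓘(ℝ, B) (fun y ↦ (e ⟨f y, s (f y)⟩).2) x v) =
    e.symmL ℝ (f x) _
  rw [h2]
  generalize mvfderiv 𝓘(ℝ, B') (fun y ↦ (e ⟨y, s y⟩).2) (f x) _ = w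
  -- It remains to identify the inverses of `e.pullback f` over `x` and of `e` over `f x`. Both
  -- invert the same fibre map, so applying `e` and then `e.symm` to one yields the other.
  have h3 := congrArg Prod.snd ((e.pullback f).apply_mk_symm hx w)
  rw [e.symmL_apply hx, Trivialization.symmL_apply (E := (f : M → M') *ᵖ E') _ hx]
  have h4 := e.symm_apply_apply_mk hx ((e.pullback f).symm x w)
  exact h4.symm.trans (congrArg (e.symm (f x)) h3)

/-- The weights at `x` are those of `P` at `f x`, so both sums run over the same indices and agree
termwise. This is the characteristic property of a pullback connection on pulled-back sections. -/
theorem gluedCov_pullback [∀ x, IsTopologicalAddGroup (E' x)] [∀ x, ContinuousSMul ℝ (E' x)]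
    {ι : Type*} (P : TrivializationPartition B' F' E' ι) (s : Sec B' F' E') (x : M)
    (v : TangentSpace 𝓘(ℝ, B) x) :
    (P.pullback f).gluedCov (fun x ↦ s (f x)) x v =
      P.gluedCov s (f x) (mfderiv 𝓘(ℝ, B) 𝓘(ℝ, B') f x v) := by
  rw [TrivializationPartition.gluedCov_apply_eq_sum]
  refine ((P.pullback f).gluedCov_apply_eq_sum _ x v).trans ?_
  refine Finset.sum_congr rfl fun j hj ↦ ?_
  have hj' : P.weight j (f x) ≠ 0 := by simpa using hj
  exact congrArg (P.weight j (f x) • ·) (localCov_pullback f (P.triv j) s (P.mem_baseSet hj') v)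

variable [FiniteDimensional ℝ B] [IsManifold 𝓘(ℝ, B) ∞ M] [T2Space M] [SigmaCompactSpace M]
  [FiniteDimensional ℝ F] [ContMDiffVectorBundle ∞ F E 𝓘(ℝ, B)]
  [FiniteDimensional ℝ B'] [IsManifold 𝓘(ℝ, B') ∞ M'] [T2Space M'] [SigmaCompactSpace M']
  [FiniteDimensional ℝ F']
  [∀ x, IsTopologicalAddGroup (E x)] [∀ x, ContinuousSMul ℝ (E x)]
  [∀ x, IsTopologicalAddGroup (E' x)] [∀ x, ContinuousSMul ℝ (E' x)]
  {φ₀ : M → M'} {φ : ∀ x, E x →ₗ[ℝ] E' (φ₀ x)}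

/-- The linear connections `C` and `C'` are compatible with `φ`. -/
def RelatedConnections (φ : ∀ x, E x →ₗ[ℝ] E' (φ₀ x)) (C : LinearConnection B F E)
    (C' : LinearConnection B' F' E') : Prop :=
  ∀ (e : Sec B F E) (e' : Sec B' F' E'), Related φ e e' → ∀ x v,
    φ x (C.cov e x v) = C'.cov e' (φ₀ x) (mfderiv 𝓘(ℝ, B) 𝓘(ℝ, B') φ₀ x v)

namespace IsVBFibration

/-- The base map of a fibration of vector bundles as a bundled smooth map. -/
def baseMap (h : IsVBFibration B F B' F' φ₀ φ) : C^∞⟮𝓘(ℝ, B), M; 𝓘(ℝ, B'), M'⟯ :=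
  ⟨φ₀, h.base_smooth⟩

/-- The morphism `φ^! : E → φ₀^!E'`. -/
def toPullback (h : IsVBFibration B F B' F' φ₀ φ) (x : M) :
    E x →L[ℝ] ((h.baseMap : M → M') *ᵖ E') x where
  toLinearMap := φ x
  -- The fibre carries the topology induced from the total space, so fibrewise continuity follows
  -- from that of the total map.
  cont := (FiberBundle.totalSpaceMk_isInducing F' E' (φ₀ x)).continuous_iff.2
    (h.smooth.continuous.comp (FiberBundle.continuous_totalSpaceMk F E x))

/-- Smoothness of the total map of `φ` becomes smoothness as a section of the Hom bundle, tested on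
sections of `E`. -/
theorem contMDiff_toPullback (h : IsVBFibration B F B' F' φ₀ φ) :
    ContMDiff 𝓘(ℝ, B) (𝓘(ℝ, B).prod 𝓘(ℝ, F →L[ℝ] F')) ∞ (fun x ↦ TotalSpace.mk' (F →L[ℝ] F')
      (E := fun x ↦ E x →L[ℝ] ((h.baseMap : M → M') *ᵖ E') x) x (h.toPullback x)) := fun _ ↦
  contMDiffAt_hom_of_apply fun s ↦
    (contMDiff_pullback_section h.baseMap (h.smooth.comp s.contMDiff)).contMDiffAt

theorem toPullback_surjective (h : IsVBFibration B F B' F' φ₀ φ) (x : M) :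
    Function.Surjective (h.toPullback x) := h.fibre_surjective x

/-- Every section of `E'` is `φ`-related to a section of `E`. -/
theorem exists_related (h : IsVBFibration B F B' F' φ₀ φ) (e' : Sec B' F' E') :
    ∃ e : Sec B F E, Related φ e e' := by
  obtain ⟨σ, hσ⟩ := exists_splitting h.contMDiff_toPullback h.toPullback_surjective
  exact ⟨⟨_, σ.contMDiff.clm_bundle_apply (contMDiff_pullback_section h.baseMap
    (e'.contMDiff.comp h.base_smooth))⟩, fun x ↦ hσ x (e' (φ₀ x))⟩

/-- There are linear connections on `E` and `E'` that are compatible with `φ`. -/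
theorem exists_related_connections (h : IsVBFibration B F B' F' φ₀ φ) :
    ∃ (C : LinearConnection B F E) (C' : LinearConnection B' F' E'), RelatedConnections φ C C' := by
  obtain ⟨P⟩ := exists_trivializationPartition B' F' E'
  obtain ⟨C, hC⟩ := exists_lift_connection h.contMDiff_toPullback h.toPullback_surjective
    (P.pullback h.baseMap).connection
  refine ⟨C, P.connection, fun e e' hr x v ↦ (hC e x v).trans ?_⟩
  have h1 : (fun y ↦ h.toPullback y (e y)) = fun y ↦ e' (h.baseMap y) := funext hr
  rw [h1]
  exact gluedCov_pullback h.baseMap P e' x v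

end IsVBFibration

end Pullback

/-! ### The induced flat connection and its Atiyah class -/

section Fibration

variable {B : Type*} [NormedAddCommGroup B] [NormedSpace ℝ B] [FiniteDimensional ℝ B]
  {M : Type*} [TopologicalSpace M] [ChartedSpace B M] [IsManifold 𝓘(ℝ, B) ∞ M]
  [T2Space M] [SigmaCompactSpace M]
  {F : Type*} [NormedAddCommGroup F] [NormedSpace ℝ F] [FiniteDimensional ℝ F]
  {E : M → Type*} [TopologicalSpace (TotalSpace F E)] [∀ x, AddCommGroup (E x)]
  [∀ x, Module ℝ (E x)] [∀ x, TopologicalSpace (E x)] [∀ x, IsTopologicalAddGroup (E x)]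
  [∀ x, ContinuousSMul ℝ (E x)] [FiberBundle F E] [VectorBundle ℝ F E]
  [ContMDiffVectorBundle ∞ F E 𝓘(ℝ, B)]
  {B' : Type*} [NormedAddCommGroup B'] [NormedSpace ℝ B'] [FiniteDimensional ℝ B']
  {M' : Type*} [TopologicalSpace M'] [ChartedSpace B' M'] [IsManifold 𝓘(ℝ, B') ∞ M']
  [T2Space M'] [SigmaCompactSpace M']
  {F' : Type*} [NormedAddCommGroup F'] [NormedSpace ℝ F'] [FiniteDimensional ℝ F']
  {E' : M' → Type*} [TopologicalSpace (TotalSpace F' E')] [∀ x, AddCommGroup (E' x)]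
  [∀ x, Module ℝ (E' x)] [∀ x, TopologicalSpace (E' x)] [∀ x, IsTopologicalAddGroup (E' x)]
  [∀ x, ContinuousSMul ℝ (E' x)] [FiberBundle F' E'] [VectorBundle ℝ F' E']
  [ContMDiffVectorBundle ∞ F' E' 𝓘(ℝ, B')]
  {φ₀ : M → M'} {φ : ∀ x, E x →ₗ[ℝ] E' (φ₀ x)}

/-! ### Related sections generate -/

theorem Sec.sum_apply {ι : Type*} (t : Finset ι) (s : ι → Sec B F E) (x : M) :
    (∑ i ∈ t, s i) x = ∑ i ∈ t, s i x := by
  have h := map_sum (ContMDiffSection.coeAddHom 𝓘(ℝ, B) F ∞ E) s t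
  exact (congrFun h x).trans (Finset.sum_apply x t _)

theorem related_zero_iff (k : Sec B F E) :
    Related φ k (0 : Sec B' F' E') ↔ k ∈ subSec B F (kerFamily φ) := Iff.rfl

namespace IsVBFibration

/-- Locally, `Γ(E/ker φ)` is generated by the classes of the sections that are related to sections
of `E'`. -/
theorem exists_smul_mem_span (h : IsVBFibration B F B' F' φ₀ φ) (s : QuotSec B F (kerFamily φ))
    (x₀ : M) : ∃ χ : Fn B M, χ x₀ = 1 ∧ χ • s ∈ Submodule.span (Fn B M)
      {t | ∃ (e : Sec B F E) (e' : Sec B' F' E'), Related φ e e' ∧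
        QuotSec.proj (kerFamily φ) e = t} := by
  obtain ⟨s, rfl⟩ := QuotSec.proj_surjective s
  set e := trivializationAt F' E' (φ₀ x₀)
  have hx₀ : φ₀ x₀ ∈ e.baseSet := mem_baseSet_trivializationAt F' E' (φ₀ x₀)
  -- The cutoff lives on `M'`, so that the cut-off frame `t'` consists of global sections of `E'`
  -- and lifts to related sections `t` of `E`.
  obtain ⟨χ, hχ, hχs⟩ := exists_fn_eventually_eq_one (B := B') (e.open_baseSet.mem_nhds hx₀)
  let b := Module.finBasis ℝ F'
  let t' (i) : Sec B' F' E' := ⟨fun y ↦ χ y • e.symm y (b i),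
    ContMDiffOn.smul_section_of_tsupport χ.contMDiff.contMDiffOn e.open_baseSet hχs
      (contMDiffOn_symm e e.open_baseSet subset_rfl contMDiffOn_const)⟩
  choose t ht using fun i ↦ h.exists_related (t' i)
  let c (i) (x : M) : ℝ := b.coord i (e ⟨φ₀ x, φ x (s x)⟩).2
  let f (i) : Fn B M := ⟨fun x ↦ χ (φ₀ x) • c i x, contMDiff_of_tsupport fun x hx ↦ by
    have hx' : φ₀ x ∈ e.baseSet := hχs (tsupport_comp_subset_preimage _ h.base_smooth.continuous
      (tsupport_smul_subset_left (fun x ↦ χ (φ₀ x)) _ hx))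
    refine (χ.contMDiff.comp h.base_smooth).contMDiffAt.smul ?_
    exact (LinearMap.toContinuousLinearMap (b.coord i)).contMDiff.contMDiffAt.comp x
      ((e.contMDiffAt_iff (by rwa [e.mem_source])).1 (h.smooth.comp s.contMDiff x)).2⟩
  let χ₁ : Fn B M := χ.comp ⟨φ₀, h.base_smooth⟩
  -- One factor makes the frame sections global, the other makes the coefficients `c i` global
  -- smooth functions; hence the square.
  refine ⟨χ₁ * χ₁, ?_, ?_⟩
  · have : χ₁ x₀ = 1 := hχ.self_of_nhds
    rw [ContMDiffMap.coe_mul, Pi.mul_apply, this, one_mul]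
  have key : (χ₁ * χ₁) • QuotSec.proj (kerFamily φ) s =
      ∑ i, f i • QuotSec.proj (kerFamily φ) (t i) := by
    simp only [← map_smul, ← map_sum]
    rw [← sub_eq_zero, ← map_sub, QuotSec.proj_eq_zero_iff]
    intro x
    change φ x (((χ₁ * χ₁) • s) x - (∑ i, f i • t i) x) = 0
    rw [map_sub, sub_eq_zero, Sec.sum_apply, map_sum]
    simp only [Sec.fn_smul_apply, map_smul, ht _ x]
    change (χ (φ₀ x) * χ (φ₀ x)) • φ x (s x) =
      ∑ i, (χ (φ₀ x) • c i x) • χ (φ₀ x) • e.symm (φ₀ x) (b i)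
    by_cases hx : φ₀ x ∈ e.baseSet
    · have h1 := congrArg (e.symmL ℝ (φ₀ x)) (b.sum_repr (e ⟨φ₀ x, φ x (s x)⟩).2)
      rw [map_sum, e.symmL_apply hx, e.symm_apply_apply_mk hx] at h1
      rw [← h1, Finset.smul_sum]
      refine Finset.sum_congr rfl fun i _ ↦ ?_
      rw [map_smul, e.symmL_apply hx, smul_smul, smul_smul, smul_eq_mul]
      congr 1
      change _ * c i x = _
      ring
    -- Off the base set the frame expansion is unavailable, but the cutoff kills both sides.
    · have h0 : χ (φ₀ x) = 0 := image_eq_zero_of_notMem_tsupport fun hx' ↦ hx (hχs hx')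
      simp [h0]
  rw [key]
  exact Submodule.sum_mem _ fun i _ ↦ Submodule.smul_mem _ _
    (Submodule.subset_span ⟨t i, t' i, ht i, rfl⟩)

variable {F₂ : Type*} [NormedAddCommGroup F₂] [NormedSpace ℝ F₂]
  {V : M → Type*} [TopologicalSpace (TotalSpace F₂ V)] [∀ x, AddCommGroup (V x)]
  [∀ x, Module ℝ (V x)] [∀ x, TopologicalSpace (V x)] [FiberBundle F₂ V] [VectorBundle ℝ F₂ V]
  {S : ∀ x, Submodule ℝ (V x)}

/-- A `C^∞(M)`-linear map on `Γ(E/ker φ)` is determined by its values on the classes of the sections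
that are related to sections of `E'`. -/
theorem linearMap_eq_zero (h : IsVBFibration B F B' F' φ₀ φ)
    (T : QuotSec B F (kerFamily φ) →ₗ[Fn B M] QuotSec B F₂ S)
    (hT : ∀ (e : Sec B F E) (e' : Sec B' F' E'), Related φ e e' →
      T (QuotSec.proj (kerFamily φ) e) = 0) : T = 0 := by
  ext1 s
  ext x
  obtain ⟨χ, hχ, hs⟩ := h.exists_smul_mem_span s x
  have h1 : T (χ • s) = 0 := by
    refine (Submodule.span_le (p := LinearMap.ker T)).2 ?_ hs
    rintro _ ⟨e, e', hr, rfl⟩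
    exact hT e e' hr
  -- Linearity over functions localizes the statement: `χ • T s = 0`, and `χ` is one at `x`.
  have h2 := congrArg (fun t : QuotSec B F₂ S ↦ t.val x) ((map_smul T χ s).symm.trans h1)
  change χ x • (T s).val x = 0 at h2
  rw [hχ, one_smul] at h2
  exact h2

/-- The tangent map of the base map is a fibration of vector bundles. -/
theorem tangent (h : IsVBFibration B F B' F' φ₀ φ) :
    IsVBFibration B B B' B' (E := (TangentSpace 𝓘(ℝ, B) : M → Type _))
      (E' := (TangentSpace 𝓘(ℝ, B') : M' → Type _)) φ₀
      (fun x ↦ (mfderiv 𝓘(ℝ, B) 𝓘(ℝ, B') φ₀ x).toLinearMap) where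
  base_smooth := h.base_smooth
  base_surjective := h.base_surjective
  base_submersion := h.base_submersion
  base_connected_fibres := h.base_connected_fibres
  smooth := h.base_smooth.contMDiff_tangentMap (by simp)
  fibre_surjective := h.base_submersion

end IsVBFibration

/-! ### Projectable vector fields -/

/-- `X ∼_{φ₀} X'`: the vector fields `X` and `X'` are `φ₀`-related. -/
abbrev VecRelated (φ₀ : M → M') (X : VecField B M) (X' : VecField B' M') : Prop :=
  Related (fun x ↦ (mfderiv 𝓘(ℝ, B) 𝓘(ℝ, B') φ₀ x).toLinearMap) X X'

/-- With `c` a chart of `M'`, `Y(c ∘ φ₀)` vanishes and `X(c ∘ φ₀)` is the pullback of `G = X'(c)`.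
The commutator formula gives `[Y, X](c ∘ φ₀) = Y(G ∘ φ₀) - X(0) = 0`, and the derivative of a chart
is injective. -/
theorem lie_mem_vertical (hφ₀ : ContMDiff 𝓘(ℝ, B) 𝓘(ℝ, B') ∞ φ₀) {Y X : VecField B M}
    {X' : VecField B' M'} (hY : Y ∈ (vertical φ₀ hφ₀).Γ) (hX : VecRelated φ₀ X X') :
    lie Y X ∈ (vertical φ₀ hφ₀).Γ := by
  intro x
  set c := extChartAt 𝓘(ℝ, B') (φ₀ x) with hc
  have hcs : ContMDiffOn 𝓘(ℝ, B') 𝓘(ℝ, B') ∞ c c.source := by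
    simpa [hc, extChartAt_source] using contMDiffOn_extChartAt (I := 𝓘(ℝ, B')) (n := ∞) (x := φ₀ x)
  have ho : IsOpen c.source := isOpen_extChartAt_source (φ₀ x)
  have hx : φ₀ x ∈ c.source := mem_extChartAt_source (φ₀ x)
  have hev : ∀ᶠ y in 𝓝 x, φ₀ y ∈ c.source :=
    hφ₀.continuous.continuousAt.eventually (ho.mem_nhds hx)
  have hg : ContMDiffAt 𝓘(ℝ, B) 𝓘(ℝ, B') 2 (c ∘ φ₀) x :=
    ((hcs.contMDiffAt (ho.mem_nhds hx)).comp x hφ₀.contMDiffAt).of_le two_le_infty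
  have hcomp : ∀ y, φ₀ y ∈ c.source → ∀ v : TangentSpace 𝓘(ℝ, B) y,
      mvfderiv 𝓘(ℝ, B) (c ∘ φ₀) y v =
        mvfderiv 𝓘(ℝ, B') c (φ₀ y) (mfderiv 𝓘(ℝ, B) 𝓘(ℝ, B') φ₀ y v) :=
    fun y hy v ↦ mfderiv_comp_apply y ((hcs.contMDiffAt (ho.mem_nhds hy)).mdifferentiableAt
      (by simp)) (hφ₀.mdifferentiable (by simp) y) v
  have hY0 : (fun y ↦ mvfderiv 𝓘(ℝ, B) (c ∘ φ₀) y (Y y)) =ᶠ[𝓝 x] fun _ ↦ (0 : B') := by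
    filter_upwards [hev] with y hy
    rw [hcomp y hy]
    exact (congrArg _ (hY y)).trans (map_zero _)
  let G : M' → B' := fun z ↦ mvfderiv 𝓘(ℝ, B') c z (X' z)
  have hG : MDifferentiableAt 𝓘(ℝ, B') 𝓘(ℝ, B') G (φ₀ x) :=
    ((contMDiffOn_mvfderiv_apply ho hcs X').contMDiffAt (ho.mem_nhds hx)).mdifferentiableAt (by simp)
  have hX0 : (fun y ↦ mvfderiv 𝓘(ℝ, B) (c ∘ φ₀) y (X y)) =ᶠ[𝓝 x] G ∘ φ₀ := by
    filter_upwards [hev] with y hy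
    rw [hcomp y hy]
    exact congrArg _ (hX y)
  have hGφ : MDifferentiableAt 𝓘(ℝ, B) 𝓘(ℝ, B') (G ∘ φ₀) x :=
    hG.comp x (hφ₀.mdifferentiable (by simp) x)
  have key := mvfderiv_mlieBracket hg Y X
    ((mdifferentiableAt_const (c := (0 : B'))).congr_of_eventuallyEq hY0)
    (hGφ.congr_of_eventuallyEq hX0)
  have hGY : mvfderiv 𝓘(ℝ, B) (G ∘ φ₀) x (Y x) = 0 :=
    (mfderiv_comp_apply x hG (hφ₀.mdifferentiable (by simp) x) (Y x)).trans
      ((congrArg _ (hY x)).trans (map_zero _))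
  rw [mvfderiv_congr hY0, mvfderiv_congr hX0, hGY, mvfderiv_const, hcomp x hx] at key
  have hinj := (isInvertible_mfderiv_extChartAt (I := 𝓘(ℝ, B')) hx).injective
  refine hinj (?_ : _ = mfderiv 𝓘(ℝ, B') 𝓘(ℝ, B') c (φ₀ x) 0)
  rw [map_zero]
  exact key.trans (sub_zero 0)

/-! ### Related connections -/

namespace RelatedConnections

variable {C : LinearConnection B F E} {C' : LinearConnection B' F' E'}

theorem related_nabla (hC : RelatedConnections φ C C') {X : VecField B M} {X' : VecField B' M'}
    (hX : VecRelated φ₀ X X') {e : Sec B F E} {e' : Sec B' F' E'} (he : Related φ e e') :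
    Related φ (C.nabla X e) (C'.nabla X' e') := fun x ↦
  (hC e e' he x (X x)).trans (congrArg (C'.cov e' (φ₀ x)) (hX x))

/-- Sections of `ker φ` are the sections related to `0`, and `C'` annihilates the zero section. -/
theorem nabla_mem_of_mem (hC : RelatedConnections φ C C') (X : VecField B M) (k : Sec B F E)
    (hk : k ∈ subSec B F (kerFamily φ)) : C.nabla X k ∈ subSec B F (kerFamily φ) := fun x ↦ by
  refine (hC k 0 ((related_zero_iff k).2 hk) x (X x)).trans ?_
  have h : C'.cov (0 : Sec B' F' E') = 0 := C'.cov.zero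
  rw [h]
  rfl

theorem nabla_mem_of_vertical (hC : RelatedConnections φ C C') {Y : VecField B M}
    (hY : ∀ x, mfderiv 𝓘(ℝ, B) 𝓘(ℝ, B') φ₀ x (Y x) = 0) {e : Sec B F E} {e' : Sec B' F' E'}
    (he : Related φ e e') : C.nabla Y e ∈ subSec B F (kerFamily φ) := fun x ↦
  (hC e e' he x (Y x)).trans ((congrArg (C'.cov e' (φ₀ x)) (hY x)).trans (map_zero _))

/-- The three terms of the curvature lie in `Γ(ker φ)` separately: `∇_X e` is related to `∇'_{X'}
e'`, `∇_Y e` is in the preserved submodule `Γ(ker φ)`, and `[Y, X]` is vertical. -/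
theorem curv_mem_of_related (hC : RelatedConnections φ C C')
    {hφ₀ : ContMDiff 𝓘(ℝ, B) 𝓘(ℝ, B') ∞ φ₀} {Y X : VecField B M} {X' : VecField B' M'}
    (hY : Y ∈ (vertical φ₀ hφ₀).Γ) (hX : VecRelated φ₀ X X') {e : Sec B F E} {e' : Sec B' F' E'}
    (he : Related φ e e') : C.curv Y X e ∈ subSec B F (kerFamily φ) :=
  Submodule.sub_mem _ (Submodule.sub_mem _
    (hC.nabla_mem_of_vertical hY (hC.related_nabla hX he))
    (hC.nabla_mem_of_mem X _ (hC.nabla_mem_of_vertical hY he)))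
    (hC.nabla_mem_of_vertical (lie_mem_vertical hφ₀ hY hX) he)

/-- Curvature is tensorial in `e` and descends to `Γ(E/ker φ)`, where vanishing on related sections
is enough. This frees `e` from being related; `X` must still be projectable. -/
theorem proj_curv_eq_zero (hφ : IsVBFibration B F B' F' φ₀ φ) (hC : RelatedConnections φ C C')
    {Y X : VecField B M} {X' : VecField B' M'} (hY : Y ∈ (vertical φ₀ hφ.base_smooth).Γ)
    (hX : VecRelated φ₀ X X') (e : Sec B F E) :
    QuotSec.proj (kerFamily φ) (C.curv Y X e) = 0 := by
  have hK : ∀ k ∈ subSec B F (kerFamily φ), ((QuotSec.proj (kerFamily φ)).comp (C.curvEnd Y X)) k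
      = 0 := fun k hk ↦ (QuotSec.proj_eq_zero_iff _).2 <| Submodule.sub_mem _ (Submodule.sub_mem _
    (hC.nabla_mem_of_mem _ _ (hC.nabla_mem_of_mem _ _ hk))
    (hC.nabla_mem_of_mem _ _ (hC.nabla_mem_of_mem _ _ hk))) (hC.nabla_mem_of_mem _ _ hk)
  have h := hφ.linearMap_eq_zero (QuotSec.lift _ hK) fun e e' he ↦
    (QuotSec.lift_proj _ hK e).trans
      ((QuotSec.proj_eq_zero_iff _).2 (hC.curv_mem_of_related hY hX he))
  exact (QuotSec.lift_proj _ hK e).symm.trans (LinearMap.congr_fun h _)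

/-- The partial connection on `E/ker φ` induced by `C`. -/
def quotNabla (φ : ∀ x, E x →ₗ[ℝ] E' (φ₀ x)) (C : LinearConnection B F E) (Y : VecField B M)
    (s : QuotSec B F (kerFamily φ)) : QuotSec B F (kerFamily φ) :=
  QuotSec.proj (kerFamily φ) (C.nabla Y (Function.surjInv QuotSec.proj_surjective s))

/-- Independence of the chosen representative: two of them differ by a section of `ker φ`, which `C`
preserves. -/
theorem quotNabla_proj (hC : RelatedConnections φ C C') (Y : VecField B M) (e : Sec B F E) :
    quotNabla φ C Y (QuotSec.proj (kerFamily φ) e) = QuotSec.proj (kerFamily φ) (C.nabla Y e) := by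
  have h := Function.surjInv_eq (QuotSec.proj_surjective (S := kerFamily φ) (B := B) (F := F))
    (QuotSec.proj (kerFamily φ) e)
  rw [← sub_eq_zero, ← map_sub, QuotSec.proj_eq_zero_iff] at h
  rw [quotNabla, ← sub_eq_zero, ← map_sub, ← C.nabla_sub_right, QuotSec.proj_eq_zero_iff]
  exact hC.nabla_mem_of_mem Y _ h

/-- The flat partial connection induced by related connections. -/
def flatConnection (hφ : IsVBFibration B F B' F' φ₀ φ) (hC : RelatedConnections φ C C') :
    FlatPartialConnection B F (vertical φ₀ hφ.base_smooth) (kerFamily φ) where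
  toFun Y s := quotNabla φ C Y s
  add_left Y₁ Y₂ s := by
    obtain ⟨e, rfl⟩ := QuotSec.proj_surjective s
    simp only [hC.quotNabla_proj, Submodule.coe_add, C.nabla_add_left, map_add]
  smul_left f Y s := by
    obtain ⟨e, rfl⟩ := QuotSec.proj_surjective s
    simp only [hC.quotNabla_proj, Submodule.coe_smul, C.nabla_smul_left, map_smul]
  add_right Y s t := by
    obtain ⟨e, rfl⟩ := QuotSec.proj_surjective s
    obtain ⟨e', rfl⟩ := QuotSec.proj_surjective t
    rw [← map_add, hC.quotNabla_proj, hC.quotNabla_proj, hC.quotNabla_proj, C.nabla_add_right,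
      map_add]
  leibniz Y f s := by
    obtain ⟨e, rfl⟩ := QuotSec.proj_surjective s
    rw [← map_smul, hC.quotNabla_proj, hC.quotNabla_proj, C.nabla_smul_right, map_add, map_smul,
      map_smul]
  flat Y₁ Y₂ s := by
    obtain ⟨e, rfl⟩ := QuotSec.proj_surjective s
    simp only [hC.quotNabla_proj]
    rw [← map_sub, ← map_sub]
    -- A vertical field is projectable to the zero field, so flatness is an instance of the
    -- curvature vanishing.
    exact proj_curv_eq_zero hφ hC Y₁.2 (X' := 0) Y₂.2 e

theorem isInducedConnection_flatConnection (hφ : IsVBFibration B F B' F' φ₀ φ)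
    (hC : RelatedConnections φ C C') : IsInducedConnection B' F' φ (hC.flatConnection hφ) := by
  rintro Y e ⟨e', he⟩
  exact (hC.quotNabla_proj Y e).trans
    ((QuotSec.proj_eq_zero_iff _).2 (hC.nabla_mem_of_vertical Y.2 he))

theorem isExtension_flatConnection (hφ : IsVBFibration B F B' F' φ₀ φ)
    (hC : RelatedConnections φ C C') : IsExtension (hC.flatConnection hφ) C where
  restricts := hC.nabla_mem_of_mem
  extends_ Y e := (hC.quotNabla_proj Y e).symm

theorem atiyahForm_eq_zero (hφ : IsVBFibration B F B' F' φ₀ φ) (hC : RelatedConnections φ C C')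
    {D : FlatPartialConnection B F (vertical φ₀ hφ.base_smooth) (kerFamily φ)}
    (h : IsExtension D C) : atiyahForm h = 0 := by
  ext1 Y
  ext1 t
  ext1 s
  obtain ⟨e, rfl⟩ := QuotSec.proj_surjective s
  -- With `e` fixed, the form is linear in the class of `X`. The kernel family of `Tφ₀` is `F_M`, so
  -- generation for the tangent fibration reduces to projectable `X`.
  have h0 := hφ.tangent.linearMap_eq_zero
    ((LinearMap.applyₗ (QuotSec.proj (kerFamily φ) e)).comp (atiyahForm h Y)) fun X X' hX ↦
    (atiyahForm_proj h Y X e).trans (proj_curv_eq_zero hφ hC Y.2 hX e)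
  exact LinearMap.congr_fun h0 t

end RelatedConnections

/-! ### Uniqueness and independence of the extension -/

theorem FlatPartialConnection.ext_of_toFun
    {FM : InvolutiveFamily B M} {S : ∀ x, Submodule ℝ (E x)} {D₁ D₂ : FlatPartialConnection B F FM S}
    (h : ∀ Y s, D₁ Y s = D₂ Y s) : D₁ = D₂ := by
  cases D₁
  cases D₂
  congr
  exact funext fun Y ↦ funext (h Y)

theorem IsInducedConnection.unique (hφ : IsVBFibration B F B' F' φ₀ φ)
    {D₁ D₂ : FlatPartialConnection B F (vertical φ₀ hφ.base_smooth) (kerFamily φ)}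
    (h₁ : IsInducedConnection B' F' φ D₁) (h₂ : IsInducedConnection B' F' φ D₂) : D₁ = D₂ := by
  refine FlatPartialConnection.ext_of_toFun fun Y s ↦ ?_
  -- The Leibniz terms cancel in the difference, so it is tensorial and is tested on related
  -- sections, which both connections kill.
  let T : QuotSec B F (kerFamily φ) →ₗ[Fn B M] QuotSec B F (kerFamily φ) :=
    { toFun := fun s ↦ D₁ Y s - D₂ Y s
      map_add' := fun s t ↦ by rw [D₁.add_right, D₂.add_right]; abel
      map_smul' := fun f s ↦ by
        rw [D₁.leibniz, D₂.leibniz, RingHom.id_apply, smul_sub]; abel }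
  have hT : T = 0 := hφ.linearMap_eq_zero T fun e e' he ↦ by
    change D₁ Y _ - D₂ Y _ = 0
    rw [h₁ Y e ⟨e', he⟩, h₂ Y e ⟨e', he⟩, sub_zero]
  exact sub_eq_zero.1 (LinearMap.congr_fun hT s)

section Difference

variable {FM : InvolutiveFamily B M} {S : ∀ x, Submodule ℝ (E x)}
  {D : FlatPartialConnection B F FM S} {C₁ C₂ : LinearConnection B F E}

/-- The difference of two extensions along a vector field, on `Γ(E/S)`. -/
def differenceEnd (h₁ : IsExtension D C₁) (h₂ : IsExtension D C₂) (X : VecField B M) :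
    QuotSec B F S →ₗ[Fn B M] QuotSec B F S :=
  QuotSec.lift
    { toFun := fun e ↦ QuotSec.proj S (C₁.nabla X e - C₂.nabla X e)
      map_add' := fun e e' ↦ by
        rw [C₁.nabla_add_right, C₂.nabla_add_right, ← map_add]
        congr 1
        abel
      map_smul' := fun f e ↦ by
        rw [C₁.nabla_smul_right, C₂.nabla_smul_right, RingHom.id_apply, ← map_smul, smul_sub]
        congr 1
        abel }
    fun e he ↦ (QuotSec.proj_eq_zero_iff _).2
      (Submodule.sub_mem _ (h₁.restricts X e he) (h₂.restricts X e he))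

theorem differenceEnd_proj (h₁ : IsExtension D C₁) (h₂ : IsExtension D C₂) (X : VecField B M)
    (e : Sec B F E) : differenceEnd h₁ h₂ X (QuotSec.proj S e) =
      QuotSec.proj S (C₁.nabla X e) - QuotSec.proj S (C₂.nabla X e) :=
  (QuotSec.lift_proj _ _ e).trans (map_sub (QuotSec.proj S) _ _)

/-- The difference of two extensions as a section of `Hom(TM/F_M, End(E/S))`. -/
def differenceForm (h₁ : IsExtension D C₁) (h₂ : IsExtension D C₂) : Form0 B F FM S :=
  QuotSec.lift
    { toFun := differenceEnd h₁ h₂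
      map_add' := fun X X' ↦ by
        ext1 s
        obtain ⟨e, rfl⟩ := QuotSec.proj_surjective s
        simp only [LinearMap.add_apply, differenceEnd_proj, LinearConnection.nabla_add_left, map_add]
        abel
      map_smul' := fun f X ↦ by
        ext1 s
        obtain ⟨e, rfl⟩ := QuotSec.proj_surjective s
        simp only [LinearMap.smul_apply, differenceEnd_proj, LinearConnection.nabla_smul_left,
          map_smul, RingHom.id_apply, smul_sub] }
    fun X hX ↦ by
      ext1 s
      obtain ⟨e, rfl⟩ := QuotSec.proj_surjective s
      refine (differenceEnd_proj h₁ h₂ X e).trans ?_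
      -- Along `F_M` both extensions induce the same `D`, so the difference descends to `TM/F_M`.
      rw [h₁.extends_ ⟨X, hX⟩, h₂.extends_ ⟨X, hX⟩, sub_self]
      rfl

theorem differenceForm_proj (h₁ : IsExtension D C₁) (h₂ : IsExtension D C₂) (X : VecField B M)
    (e : Sec B F E) : differenceForm h₁ h₂ (QuotSec.proj FM.fiber X) (QuotSec.proj S e) =
      QuotSec.proj S (C₁.nabla X e) - QuotSec.proj S (C₂.nabla X e) := by
  rw [differenceForm, QuotSec.lift_proj]
  exact differenceEnd_proj h₁ h₂ X e

/-- Expanding both sides leaves only the mixed term `∇²_X ∇¹_Y e` in place of `∇²_X ∇²_Y e`. They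
agree modulo `S`: `∇¹_Y e - ∇²_Y e` is a section of `S` because both project to `D_Y ē`, and `∇²_X`
preserves `Γ(S)`. -/
theorem d0_differenceForm (h₁ : IsExtension D C₁) (h₂ : IsExtension D C₂) :
    d0 D (differenceForm h₁ h₂) = atiyahForm h₁ - atiyahForm h₂ := by
  ext1 Y
  ext1 t
  ext1 s
  obtain ⟨e, rfl⟩ := QuotSec.proj_surjective s
  obtain ⟨X, rfl⟩ := QuotSec.proj_surjective t
  change homConn D Y (differenceForm h₁ h₂) _ _ = atiyahForm h₁ Y _ _ - atiyahForm h₂ Y _ _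
  have hk : QuotSec.proj S (C₂.nabla X (C₁.nabla Y e)) =
      QuotSec.proj S (C₂.nabla X (C₂.nabla Y e)) := by
    rw [← sub_eq_zero, ← map_sub, ← C₂.nabla_sub_right, QuotSec.proj_eq_zero_iff]
    refine h₂.restricts X _ ((QuotSec.proj_eq_zero_iff _).1 ?_)
    rw [map_sub, h₁.extends_, h₂.extends_, sub_self]
  rw [homConn_apply, bott_proj, atiyahForm_proj, atiyahForm_proj, ← h₁.extends_ Y e,
    differenceForm_proj, differenceForm_proj, differenceForm_proj, D.sub_right, hk,
    LinearConnection.curv, LinearConnection.curv]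
  simp only [map_sub]
  rw [← h₁.extends_ Y (C₁.nabla X e), ← h₂.extends_ Y (C₂.nabla X e)]
  abel

/-- The class of `ω_∇` does not depend on the extension `∇`. -/
theorem atiyahFormClass_eq (h₁ : IsExtension D C₁) (h₂ : IsExtension D C₂) :
    atiyahFormClass h₁ = atiyahFormClass h₂ := by
  refine (Submodule.Quotient.eq _).2 ?_
  exact ⟨differenceForm h₁ h₂, d0_differenceForm h₁ h₂⟩

end Difference

theorem isAtiyahClass_zero (hφ : IsVBFibration B F B' F' φ₀ φ) {C : LinearConnection B F E}
    {C' : LinearConnection B' F' E'} (hC : RelatedConnections φ C C') :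
    IsAtiyahClass (hC.flatConnection hφ) 0 := by
  have h₀ := hC.isExtension_flatConnection hφ
  refine ⟨⟨C, h₀⟩, fun C₁ h ↦ (atiyahFormClass_eq h h₀).trans ?_⟩
  refine (Submodule.Quotient.mk_eq_zero _).2 ?_
  exact ⟨0, (map_zero _).trans (hC.atiyahForm_eq_zero hφ h₀).symm⟩

end Fibration

end FlatFibration

end

theorem mainTheorem5
    {B : Type*} [NormedAddCommGroup B] [NormedSpace ℝ B] [FiniteDimensional ℝ B]
    {M : Type*} [TopologicalSpace M] [ChartedSpace B M] [IsManifold 𝓘(ℝ, B) ∞ M]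
    [T2Space M] [SigmaCompactSpace M]
    {F : Type*} [NormedAddCommGroup F] [NormedSpace ℝ F] [FiniteDimensional ℝ F]
    {E : M → Type*} [TopologicalSpace (TotalSpace F E)] [∀ x, AddCommGroup (E x)]
    [∀ x, Module ℝ (E x)] [∀ x, TopologicalSpace (E x)] [∀ x, IsTopologicalAddGroup (E x)]
    [∀ x, ContinuousSMul ℝ (E x)] [FiberBundle F E] [VectorBundle ℝ F E]
    [ContMDiffVectorBundle ∞ F E 𝓘(ℝ, B)]
    {B' : Type*} [NormedAddCommGroup B'] [NormedSpace ℝ B'] [FiniteDimensional ℝ B']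
    {M' : Type*} [TopologicalSpace M'] [ChartedSpace B' M'] [IsManifold 𝓘(ℝ, B') ∞ M']
    [T2Space M'] [SigmaCompactSpace M']
    {F' : Type*} [NormedAddCommGroup F'] [NormedSpace ℝ F'] [FiniteDimensional ℝ F']
    {E' : M' → Type*} [TopologicalSpace (TotalSpace F' E')] [∀ x, AddCommGroup (E' x)]
    [∀ x, Module ℝ (E' x)] [∀ x, TopologicalSpace (E' x)] [∀ x, IsTopologicalAddGroup (E' x)]
    [∀ x, ContinuousSMul ℝ (E' x)] [FiberBundle F' E'] [VectorBundle ℝ F' E']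
    [ContMDiffVectorBundle ∞ F' E' 𝓘(ℝ, B')]
    (φ₀ : M → M') (φ : ∀ x, E x →ₗ[ℝ] E' (φ₀ x))
    (hφ : FlatFibration.IsVBFibration B F B' F' φ₀ φ) :
    (∃! D : FlatFibration.FlatPartialConnection B F
        (FlatFibration.vertical φ₀ hφ.base_smooth) (FlatFibration.kerFamily φ),
      FlatFibration.IsInducedConnection B' F' φ D) ∧
    ∀ D : FlatFibration.FlatPartialConnection B F
        (FlatFibration.vertical φ₀ hφ.base_smooth) (FlatFibration.kerFamily φ),
      FlatFibration.IsInducedConnection B' F' φ D → FlatFibration.IsAtiyahClass D 0 := by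
  -- One compatible pair serves for everything: it induces the flat connection, and `C` is an
  -- extension with vanishing form. Uniqueness identifies an arbitrary induced `D` with this one.
  obtain ⟨C, C', hC⟩ := hφ.exists_related_connections
  have hD := hC.isInducedConnection_flatConnection hφ
  refine ⟨⟨hC.flatConnection hφ, hD, fun D h ↦ h.unique hφ hD⟩, fun D h ↦ ?_⟩
  rw [h.unique hφ hD]
  exact FlatFibration.isAtiyahClass_zero hφ hC
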